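/- Let $r\ge 2$. An ordered $r$-matching of size $n$ is a set of $n$ pairwise disjoint $r$-element edges covering the vertex set $[rn]=\{1,\dots,rn\}$; let $\mathbb{RM}^{(r)}_n$ be chosen uniformly at random among all of them. An $r$-pattern is an ordered $r$-matching of size $2$; it is written as a word of length $2r$ in which each of the letters $A,B$ occurs $r$ times (the positions of $A$ form one edge, those of $B$ the other; exchanging $A$ and $B$ in the whole word gives the same pattern). Two disjoint $r$-sets $e,f$ of vertices form the pattern $P$ if $\{e,f\}$ is order-isomorphic to $P$. For a set $\mathcal P$ of $r$-patterns, a $\mathcal P$-clique is an $r$-matching in which every two distinct edges form a pattern from $\mathcal P$, and $z_{\mathcal P}(M)$ denotes the largest size of a $\mathcal P$-clique contained in the matching $M$. A pattern $P$ is collectable if there are arbitrarily large $\{P\}$-cliques. Let $P$ be a collectable $r$-pattern. Then there is exactly one composition $\lambda=(\lambda_1,\dots,\lambda_s)$ of $r$ such that $P$ splits into consecutive blocks $P=S_1S_2\cdots S_s$ with $S_i=A^{\lambda_i}B^{\lambda_i}$ or $S_i=B^{\lambda_i}A^{\lambda_i}$ for each $i$. Let $\pi$ be a partition of $[s]$ into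 $t+1$ nonempty parts $T_0,T_1,\dots,T_t$ with $1\in T_0$. For $F\subseteq\{1,\dots,t\}$ let $P_F$ be the pattern obtained from $P$ by exchanging the letters $A$ and $B$ in all blocks $S_i$ with $i\in\bigcup_{j\in F}T_j$, and let $\mathcal C(P,\pi)=\{P_F: F\subseteq\{1,\dots,t\}\}$. Then a.a.s. $$z_{\mathcal C(P,\pi)}(\mathbb{RM}^{(r)}_n)=\Theta\bigl(n^{1/(r-t)}\bigr),$$ that is, there are constants $a,b>0$ such that, with probability tending to $1$ as $n\to\infty$, $$a\,n^{1/(r-t)}\le z_{\mathcal C(P,\pi)}(\mathbb{RM}^{(r)}_n)\le b\,n^{1/(r-t)}.$$ -/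

import Mathlib

open Filter Topology

namespace OrdMatch

/-- `M` is an `r`-matching: its edges have size `r` and are pairwise disjoint. -/
def IsMatching {V : Type*} [DecidableEq V] (r : ℕ) (M : Finset (Finset V)) : Prop :=
  (∀ e ∈ M, e.card = r) ∧ ∀ e ∈ M, ∀ f ∈ M, e ≠ f → Disjoint e f

instance {V : Type*} [DecidableEq V] (r : ℕ) (M : Finset (Finset V)) :
    Decidable (IsMatching r M) := by
  unfold IsMatching; infer_instance

/-- The family of all ordered `r`-matchings of size `n` on the vertex set `[rn]`
(for `r ≥ 1` the `n` disjoint edges of size `r` leave no vertex isolated). -/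
def orderedMatchings (r n : ℕ) : Finset (Finset (Finset (Fin (r * n)))) :=
  Finset.univ.filter fun M => IsMatching r M ∧ M.card = n

/-- An `r`-pattern is an ordered `r`-matching of size two (on the vertex set `[2r]`). -/
abbrev Pattern (r : ℕ) : Type :=
  {P : Finset (Finset (Fin (r * 2))) // P ∈ orderedMatchings r 2}

/-- The pair of edges `{e, f}` forms the pattern `P`, that is, it is order-isomorphic to `P`. -/
def Forms {V : Type*} [LinearOrder V] {r : ℕ} (e f : Finset V) (P : Pattern r) : Prop :=
  ∃ φ : Fin (r * 2) ↪o V, P.1.image (fun a => a.map φ.toEmbedding) = {e, f}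

/-- Every pair of edges of `K` forms a pattern from the set `S` of patterns.
For an `r`-matching `K` this says that `K` is an `S`-clique. -/
def IsClique {V : Type*} [LinearOrder V] {r : ℕ} (S : Set (Pattern r))
    (K : Finset (Finset V)) : Prop :=
  ∀ e ∈ K, ∀ f ∈ K, e ≠ f → ∃ P ∈ S, Forms e f P

open Classical in
/-- The maximum size of an `S`-clique contained in the matching `M`. -/
noncomputable def maxClique {V : Type*} [LinearOrder V] {r : ℕ} (S : Set (Pattern r))
    (M : Finset (Finset V)) : ℕ :=
  (M.powerset.filter fun K => IsClique S K).sup Finset.card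

/-- A pattern `P` is collectable if there are arbitrarily large `P`-cliques. -/
def Collectable {r : ℕ} (P : Pattern r) : Prop :=
  ∀ m : ℕ, ∃ k ≥ m, ∃ K ∈ orderedMatchings r k, IsClique {P} K

/-- The two-letter word `w` of length `2r` represents `P`: one edge of `P` consists of the
positions of the letter `A`, the other of the positions of `B` (`A` is `false`, `B` is `true`). -/
def Represents {r : ℕ} (w : Fin (r * 2) → Bool) (P : Pattern r) : Prop :=
  P.1 = {Finset.univ.filter (fun p => w p = false), Finset.univ.filter (fun p => w p = true)}

/-- If a word of length `2r` is cut into consecutive segments of lengths `2 * c₁, …, 2 * cₛ`,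
where `c` is a composition of `r`, then position `p` lies in the segment `segment c p`. -/
def segment {r : ℕ} (c : Composition r) (p : Fin (r * 2)) : Fin c.length :=
  c.index ⟨p.1 / 2, by have := p.2; omega⟩

/-- `P` splits into consecutive blocks `S₁ ⋯ Sₛ`, where each `Sᵢ` has length `2 * cᵢ` and is
`A⋯AB⋯B` or `B⋯BA⋯A`, with `cᵢ` letters of each kind; `c` is then the composition of `P`. -/
def IsSplitting {r : ℕ} (P : Pattern r) (c : Composition r) : Prop :=
  ∃ w : Fin (r * 2) → Bool, Represents w P ∧
    ∀ i : Fin c.length, ∃ x : Bool, ∀ p, segment c p = i →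
      w p = if p.1 < 2 * c.sizeUpTo i + c.blocksFun i then x else !x

/-- Exchange the letters `A` and `B` in all segments whose index lies in a member of `F`. -/
def flip {r : ℕ} (c : Composition r) (F : Finset (Finset (Fin c.length)))
    (w : Fin (r * 2) → Bool) : Fin (r * 2) → Bool :=
  fun p => if ∃ T ∈ F, segment c p ∈ T then !(w p) else w p

/-- The cube generated by the pattern `P` with composition `c` and by a partition `π` of the set
of its segments: all patterns obtained from `P` by flipping the mega-blocks of an arbitrary
set `F` of parts of `π` other than the part that contains the first segment. -/
def cube {r : ℕ} (P : Pattern r) (c : Composition r)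
    (π : Finpartition (Finset.univ : Finset (Fin c.length))) : Set (Pattern r) :=
  {Q | ∃ w, Represents w P ∧ ∃ F ⊆ π.parts, (∀ T ∈ F, ∀ i ∈ T, i.1 ≠ 0) ∧
    Represents (flip c F w) Q}

open Classical in
/-- The probability of the event `E` for a uniformly random ordered `r`-matching of size `n`. -/
noncomputable def prob (r n : ℕ) (E : Finset (Finset (Fin (r * n))) → Prop) : ℝ :=
  (((orderedMatchings r n).filter E).card : ℝ) / ((orderedMatchings r n).card : ℝ)

end OrdMatch

/-! A word made of blocks is recorded by its composition `c` and an orientation `y` (the first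
letter of each block), and two edges form it exactly when their vertices compare as prescribed by
`Precedes`. Since exchanging the two letters globally does not change a pattern, the cube consists
of the words whose orientation is `y` flipped arbitrarily on the parts of `π`. After
`exists_mem_cube_forms_iff` only comparisons of vertices matter.

Splitting. The block ends are the numbers `v` for which the first `v` letters of each kind form a
prefix, a property of the pattern alone; hence uniqueness. For existence, three edges of a clique,
ordered by first vertex, are pairwise interleaved by the same relation `R`, and transitivity along
the three edges forces block structure (`Triple.exists_next_cut_of_rel`).

Randomness. A uniform matching is the image of a uniform bijection from (edge, label) pairs to
vertices, so probabilities concerning a few edges reduce to counting injections.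

Upper bound. In a clique of size `k`, the relative order of all `kr` vertices is determined by one
permutation of the edges per part and the order of labels inside each edge. Listing the edges by
first vertex makes the permutation of the part containing the first block trivial. The union bound
therefore gives at most n^k (k!)^t (r!)^k / (kr)!, which tends to zero for k a large multiple of
n^(1/(r-t)) (`exists_codeRel`, `first_moment_le`).

Lower bound. With q about n^(1/(r-t)), the vertex set is cut into intervals so that a "good" edge
has one coordinate in [q] for each of the t+1 parts, and two good edges with all coordinates
different form a pattern of the cube. Among a small fixed proportion of the edges there are of order
q good ones, and few pairs share a coordinate. Chebyshev's inequality controls both counts, and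
deleting one edge from each conflict leaves a clique of order q. -/

namespace OrdMatch

/-! ### Block words and the interleavings they describe -/

section Words

variable {r : ℕ}

/-- The word with blocks given by the composition `c`, where the block `i` starts with the
letter `y i`. -/
def blockWord (c : Composition r) (y : Fin c.length → Bool) (p : Fin (r * 2)) : Bool :=
  if p.1 < 2 * c.sizeUpTo (segment c p) + c.blocksFun (segment c p) then y (segment c p)
  else !(y (segment c p))

theorem index_lt_add (c : Composition r) (a : Fin r) :
    a.1 < c.sizeUpTo (c.index a) + c.blocksFun (c.index a) := by
  rw [← c.sizeUpTo_succ']; exact c.lt_sizeUpTo_index_succ a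

theorem sizeUpTo_add_le (c : Composition r) (i : Fin c.length) :
    c.sizeUpTo i + c.blocksFun i ≤ r := by
  rw [← c.sizeUpTo_succ']; exact c.sizeUpTo_le _

theorem sizeUpTo_add_le_of_lt (c : Composition r) {i j : Fin c.length} (h : i < j) :
    c.sizeUpTo i + c.blocksFun i ≤ c.sizeUpTo j := by
  rw [← c.sizeUpTo_succ']; exact c.monotone_sizeUpTo h

theorem index_eq_of_bounds (c : Composition r) {a : Fin r} {i : Fin c.length}
    (h1 : c.sizeUpTo i ≤ a.1) (h2 : a.1 < c.sizeUpTo i + c.blocksFun i) : c.index a = i := by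
  have h3 := c.sizeUpTo_index_le a
  have h4 := index_lt_add c a
  rcases lt_trichotomy (c.index a) i with h | h | h
  · have := sizeUpTo_add_le_of_lt c h; omega
  · exact h
  · have := sizeUpTo_add_le_of_lt c h; omega

theorem index_mono (c : Composition r) {a b : Fin r} (h : a ≤ b) : c.index a ≤ c.index b := by
  by_contra! hlt
  have h1 := sizeUpTo_add_le_of_lt c hlt
  have h2 := c.sizeUpTo_index_le a
  have h3 := index_lt_add c b
  have : a.1 ≤ b.1 := h
  omega

/-- The position of the `a`-th occurrence of the letter `l` in the word `blockWord c y`. -/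
def pos (c : Composition r) (y : Fin c.length → Bool) (l : Bool) (a : Fin r) : Fin (r * 2) :=
  -- The block starts at twice `sizeUpTo`, and the letter has offset `a - sizeUpTo` in its half of
  -- the block; the second half is shifted by the block size.
  ⟨a.1 + c.sizeUpTo (c.index a) + if l = y (c.index a) then 0 else c.blocksFun (c.index a), by
    have h1 := index_lt_add c a
    have h2 := sizeUpTo_add_le c (c.index a)
    split_ifs <;> omega⟩

theorem segment_eq_of_bounds (c : Composition r) {p : Fin (r * 2)} {i : Fin c.length}
    (h1 : 2 * c.sizeUpTo i ≤ p.1) (h2 : p.1 < 2 * (c.sizeUpTo i + c.blocksFun i)) :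
    segment c p = i :=
  index_eq_of_bounds c (by simp only; omega) (by simp only; omega)

theorem segment_pos (c : Composition r) (y : Fin c.length → Bool) (l : Bool) (a : Fin r) :
    segment c (pos c y l a) = c.index a := by
  have h1 := index_lt_add c a
  have h2 := c.sizeUpTo_index_le a
  apply segment_eq_of_bounds <;> simp only [pos] <;> split_ifs <;> omega

theorem blockWord_pos (c : Composition r) (y : Fin c.length → Bool) (l : Bool) (a : Fin r) :
    blockWord c y (pos c y l a) = l := by
  have h1 := index_lt_add c a
  have h2 := c.sizeUpTo_index_le a
  unfold blockWord
  rw [segment_pos]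
  by_cases h : l = y (c.index a)
  · rw [if_pos (by simp only [pos, if_pos h]; omega), h]
  · rw [if_neg (by simp only [pos, if_neg h]; omega)]
    cases l <;> cases hy : y (c.index a) <;> simp_all

theorem pos_lt_pos_same (c : Composition r) (y : Fin c.length → Bool) (l : Bool) {a b : Fin r}
    (hab : a < b) : pos c y l a < pos c y l b := by
  have h1 := index_lt_add c a
  have h2 := c.sizeUpTo_index_le a
  have h1' := index_lt_add c b
  have h2' := c.sizeUpTo_index_le b
  have hab' : a.1 < b.1 := hab
  rw [Fin.lt_def]
  rcases (index_mono c hab.le).lt_or_eq with h | h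
  · have := sizeUpTo_add_le_of_lt c h
    simp only [pos]
    split_ifs <;> omega
  · simp only [pos, h]; omega

theorem pos_strictMono (c : Composition r) (y : Fin c.length → Bool) (l : Bool) :
    StrictMono (pos c y l) := fun _ _ h => pos_lt_pos_same c y l h

/-- The order relation of the two letters of a word with blocks: the `a`-th letter `A` precedes
the `b`-th letter `B`. -/
def Precedes (c : Composition r) (y : Fin c.length → Bool) (a b : Fin r) : Prop :=
  c.index a < c.index b ∨ (c.index a = c.index b ∧ y (c.index a) = false)

theorem pos_false_lt_pos_true (c : Composition r) (y : Fin c.length → Bool) (a b : Fin r) :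
    pos c y false a < pos c y true b ↔ Precedes c y a b := by
  have h1 := index_lt_add c a
  have h2 := c.sizeUpTo_index_le a
  have h1' := index_lt_add c b
  have h2' := c.sizeUpTo_index_le b
  rw [Fin.lt_def, Precedes]
  rcases lt_trichotomy (c.index a) (c.index b) with h | h | h
  · have := sizeUpTo_add_le_of_lt c h
    simp only [h, true_or, iff_true, pos]
    split_ifs <;> omega
  · simp only [pos, h] at *
    cases hy : y (c.index b) <;> simp <;> omega
  · have := sizeUpTo_add_le_of_lt c h
    simp only [h.not_gt, h.ne', false_and, or_false, iff_false, pos]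
    split_ifs <;> omega

theorem pos_injective (c : Composition r) (y : Fin c.length → Bool) :
    Function.Injective (fun q : Bool × Fin r => pos c y q.1 q.2) := by
  rintro ⟨l, a⟩ ⟨l', b⟩ h
  simp only at h
  obtain rfl : l = l' := by rw [← blockWord_pos c y l a, h, blockWord_pos]
  rw [(pos_strictMono c y l).injective h]

theorem pos_bijective (c : Composition r) (y : Fin c.length → Bool) :
    Function.Bijective (fun q : Bool × Fin r => pos c y q.1 q.2) := by
  rw [Fintype.bijective_iff_injective_and_card]
  exact ⟨pos_injective c y, by simp [mul_comm]⟩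

theorem exists_pos_eq (c : Composition r) (y : Fin c.length → Bool) (p : Fin (r * 2)) :
    ∃ a, pos c y (blockWord c y p) a = p := by
  obtain ⟨⟨l, a⟩, rfl⟩ := (pos_bijective c y).2 p
  exact ⟨a, by simp only [blockWord_pos]⟩

theorem filter_blockWord (c : Composition r) (y : Fin c.length → Bool) (l : Bool) :
    Finset.univ.filter (fun p => blockWord c y p = l) = Finset.univ.image (pos c y l) := by
  ext p
  simp only [Finset.mem_filter, Finset.mem_univ, true_and, Finset.mem_image]
  constructor
  · rintro rfl; exact exists_pos_eq c y p
  · rintro ⟨a, rfl⟩; exact blockWord_pos c y l a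

/-- Two injections of a finite type into a linear order with the same range that induce the same
order agree. -/
theorem eq_of_range_eq_of_lt_iff {ι α : Type*} [Finite ι] [LinearOrder α] {x y : ι → α}
    (hx : Function.Injective x) (hr : Set.range x = Set.range y)
    (h : ∀ p q, x p < x q ↔ y p < y q) : x = y := by
  -- In the order pulled back along `x` both maps are strictly increasing, and such a map is
  -- determined by its range.
  let _ : LinearOrder ι := LinearOrder.lift' x hx
  have hx' : StrictMono x := fun p q hpq => hpq
  have hy' : StrictMono y := fun p q hpq => (h p q).1 hpq
  exact (StrictMono.range_inj hx' hy').1 hr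

/-- An order embedding of a two-letter word onto a pair of increasing sequences exists if and
only if the sequences are interleaved in the same way as the letters. -/
theorem exists_orderEmbedding_iff {V : Type*} [LinearOrder V] {c : Composition r}
    {y : Fin c.length → Bool} {e f : Fin r → V} (he : StrictMono e) (hf : StrictMono f)
    (hd : ∀ a b, e a ≠ f b) :
    (∃ φ : Fin (r * 2) ↪o V,
      (Finset.univ.filter (fun p => blockWord c y p = false)).map φ.toEmbedding
        = Finset.univ.image e ∧
      (Finset.univ.filter (fun p => blockWord c y p = true)).map φ.toEmbedding
        = Finset.univ.image f) ↔
    ∀ a b, e a < f b ↔ Precedes c y a b := by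
  constructor
  · rintro ⟨φ, h1, h2⟩ a b
    have key : ∀ (l : Bool) (g : Fin r → V), StrictMono g →
        (Finset.univ.filter (fun p => blockWord c y p = l)).map φ.toEmbedding
          = Finset.univ.image g → g = φ ∘ pos c y l := by
      intro l g hg h
      rw [filter_blockWord] at h
      refine (StrictMono.range_inj hg (φ.strictMono.comp (pos_strictMono c y l))).1 ?_
      ext v
      have := Finset.ext_iff.1 h v
      simp only [Finset.mem_map, Finset.mem_image, Finset.mem_univ, true_and] at this
      simp only [Set.mem_range, ← this, Function.comp]
      constructor
      · rintro ⟨_, ⟨a, rfl⟩, rfl⟩; exact ⟨a, rfl⟩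
      · rintro ⟨a, rfl⟩; exact ⟨_, ⟨a, rfl⟩, rfl⟩
    rw [key false e he h1, key true f hf h2, ← pos_false_lt_pos_true]
    exact φ.lt_iff_lt
  · intro h
    -- The embedding is forced: the `a`-th `A` goes to `e a`, the `b`-th `B` to `f b`. It is
    -- increasing by a check of the four letter pairs.
    let E : Bool × Fin r → V := fun q => if q.1 = true then f q.2 else e q.2
    let ψ := Equiv.ofBijective _ (pos_bijective c y)
    have hψ : ∀ l a, ψ.symm (pos c y l a) = (l, a) := fun l a =>
      ψ.symm_apply_eq.2 rfl
    have hm : StrictMono (E ∘ ψ.symm) := by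
      intro p q hpq
      obtain ⟨⟨l, a⟩, rfl⟩ := (pos_bijective c y).2 p
      obtain ⟨⟨l', b⟩, rfl⟩ := (pos_bijective c y).2 q
      simp only [Function.comp, hψ, E] at hpq ⊢
      cases l <;> cases l'
      · simpa using he ((pos_strictMono c y _).lt_iff_lt.1 hpq)
      · simpa using (h a b).2 ((pos_false_lt_pos_true c y a b).1 hpq)
      · have := (h b a).not.2 (fun hh => hpq.not_gt ((pos_false_lt_pos_true c y b a).2 hh))
        simpa using lt_of_le_of_ne (not_lt.1 this) (hd b a).symm
      · simpa using hf ((pos_strictMono c y _).lt_iff_lt.1 hpq)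
    refine ⟨OrderEmbedding.ofStrictMono _ hm, ?_, ?_⟩ <;>
    · rw [filter_blockWord]
      ext v
      simp [hψ, E]

end Words

/-! ### Patterns as words up to exchange of letters, and the cube -/

section Patterns

variable {r : ℕ}

theorem Represents.neg {w : Fin (r * 2) → Bool} {P : Pattern r} (h : Represents w P) :
    Represents (fun p => !(w p)) P := by
  unfold Represents at *
  rw [h, Finset.pair_comm]
  simp

theorem Represents.eq_or_eq_neg {w w' : Fin (r * 2) → Bool} {P : Pattern r}
    (h : Represents w P) (h' : Represents w' P) : w' = w ∨ w' = fun p => !(w p) := by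
  unfold Represents at *
  have hmem : Finset.univ.filter (fun p => w' p = false) ∈ P.1 := by rw [h']; simp
  rw [h, Finset.mem_insert, Finset.mem_singleton] at hmem
  rcases hmem with hh | hh
  · left
    funext p
    have := Finset.ext_iff.1 hh p
    simp only [Finset.mem_filter, Finset.mem_univ, true_and] at this
    cases h1 : w p <;> cases h2 : w' p <;> simp_all
  · right
    funext p
    have := Finset.ext_iff.1 hh p
    simp only [Finset.mem_filter, Finset.mem_univ, true_and] at this
    cases h1 : w p <;> cases h2 : w' p <;> simp_all

theorem exists_represents (P : Pattern r) : ∃ w, Represents w P := by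
  have hP := P.2
  simp only [orderedMatchings, Finset.mem_filter, Finset.mem_univ, true_and] at hP
  obtain ⟨⟨hc, hd⟩, h2⟩ := hP
  obtain ⟨X, Y, hXY, hPXY⟩ := Finset.card_eq_two.1 h2
  have hX : X ∈ P.1 := by rw [hPXY]; simp
  have hY : Y ∈ P.1 := by rw [hPXY]; simp
  have hdis := hd X hX Y hY hXY
  have hu : X ∪ Y = Finset.univ := by
    rw [← Finset.card_eq_iff_eq_univ, Finset.card_union_of_disjoint hdis, hc X hX, hc Y hY]
    simp [mul_two]
  refine ⟨fun p => decide (p ∈ Y), ?_⟩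
  unfold Represents
  rw [hPXY]
  congr 1
  · ext p
    have h1 : p ∈ X ∪ Y := by rw [hu]; simp
    have h3 : p ∈ X → p ∉ Y := fun h => Finset.disjoint_left.1 hdis h
    simp only [Finset.mem_union] at h1
    simp only [Finset.mem_filter, Finset.mem_univ, true_and, decide_eq_false_iff_not]
    tauto
  · congr 1
    ext p
    simp

/-- A pattern has two words, complementary to each other; choosing the right one lets `e` play `A`
and `f` play `B`. -/
theorem forms_iff_exists_word {V : Type*} [LinearOrder V] {e f : Finset V} {Q : Pattern r} :
    Forms e f Q ↔ ∃ w, Represents w Q ∧ ∃ φ : Fin (r * 2) ↪o V,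
      (Finset.univ.filter (fun p => w p = false)).map φ.toEmbedding = e ∧
      (Finset.univ.filter (fun p => w p = true)).map φ.toEmbedding = f := by
  constructor
  · rintro ⟨φ, hφ⟩
    obtain ⟨w, hw⟩ := exists_represents Q
    have hw' := hw
    unfold Represents at hw'
    rw [hw', Finset.image_insert, Finset.image_singleton] at hφ
    have := hφ
    rw [← Finset.coe_inj] at this
    simp only [Finset.coe_insert, Finset.coe_singleton, Set.pair_eq_pair_iff] at this
    rcases this with ⟨h1, h2⟩ | ⟨h1, h2⟩
    · exact ⟨w, hw, φ, h1, h2⟩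
    · refine ⟨_, hw.neg, φ, ?_, ?_⟩
      · simpa using h2
      · simpa using h1
  · rintro ⟨w, hw, φ, h1, h2⟩
    refine ⟨φ, ?_⟩
    unfold Represents at hw
    rw [hw, Finset.image_insert, Finset.image_singleton, h1, h2]

theorem isSplitting_iff {P : Pattern r} {c : Composition r} :
    IsSplitting P c ↔ ∃ y, Represents (blockWord c y) P := by
  constructor
  · rintro ⟨w, hw, h⟩
    choose y hy using h
    refine ⟨y, ?_⟩
    convert hw using 1
    funext p
    rw [hy _ p rfl]
    rfl
  · rintro ⟨y, hy⟩
    refine ⟨_, hy, fun i => ⟨y i, ?_⟩⟩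
    rintro p rfl
    rfl

theorem not_blockWord (c : Composition r) (y : Fin c.length → Bool) :
    (fun p => !(blockWord c y p)) = blockWord c (fun i => !(y i)) := by
  funext p
  unfold blockWord
  split_ifs <;> simp

theorem flip_blockWord (c : Composition r) (F : Finset (Finset (Fin c.length)))
    (y : Fin c.length → Bool) :
    flip c F (blockWord c y)
      = blockWord c (fun i => xor (y i) (decide (∃ T ∈ F, i ∈ T))) := by
  funext p
  unfold blockWord flip
  by_cases h : ∃ T ∈ F, segment c p ∈ T <;> simp only [h, if_true, if_false] <;>
    split_ifs <;> simp

/-- The pattern whose word has blocks given by `c`, with orientation `y`. -/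
def blockPattern (hr : 0 < r) (c : Composition r) (y : Fin c.length → Bool) : Pattern r :=
  ⟨{Finset.univ.filter (fun p => blockWord c y p = false),
    Finset.univ.filter (fun p => blockWord c y p = true)}, by
    have hc : ∀ l, (Finset.univ.filter (fun p => blockWord c y p = l)).card = r := by
      intro l
      rw [filter_blockWord, Finset.card_image_of_injective _ (pos_strictMono c y l).injective]
      simp
    have hd : Disjoint (Finset.univ.filter (fun p => blockWord c y p = false))
        (Finset.univ.filter (fun p => blockWord c y p = true)) := by
      rw [Finset.disjoint_filter]; simp +contextual
    have hne : Finset.univ.filter (fun p => blockWord c y p = false) ≠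
        Finset.univ.filter (fun p => blockWord c y p = true) := by
      intro h
      rw [h, disjoint_self, Finset.bot_eq_empty] at hd
      have := hc true
      rw [hd] at this
      simp at this
      omega
    simp only [orderedMatchings, Finset.mem_filter, Finset.mem_univ, true_and]
    refine ⟨⟨?_, ?_⟩, Finset.card_pair hne⟩
    · intro e he
      simp only [Finset.mem_insert, Finset.mem_singleton] at he
      rcases he with rfl | rfl <;> exact hc _
    · intro e he f hf hef
      simp only [Finset.mem_insert, Finset.mem_singleton] at he hf
      rcases he with rfl | rfl <;> rcases hf with rfl | rfl
      · exact absurd rfl hef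
      · exact hd
      · exact hd.symm
      · exact absurd rfl hef⟩

theorem represents_blockPattern (hr : 0 < r) (c : Composition r) (y : Fin c.length → Bool) :
    Represents (blockWord c y) (blockPattern hr c y) := rfl

/-- The exemption of the first part costs nothing: a flip of that part is equivalent, after
exchanging the letters globally, to the complementary set of flips. So `o` may be any function on
the parts. -/
theorem mem_cube_iff (hr : 0 < r) {P Q : Pattern r} {c : Composition r}
    {y : Fin c.length → Bool} (hy : Represents (blockWord c y) P)
    (π : Finpartition (Finset.univ : Finset (Fin c.length))) :
    Q ∈ cube P c π ↔ ∃ o : Finset (Fin c.length) → Bool,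
      Represents (blockWord c (fun i => xor (y i) (o (π.part i)))) Q := by
  have hpart : ∀ {F : Finset (Finset (Fin c.length))}, F ⊆ π.parts → ∀ i,
      (∃ T ∈ F, i ∈ T) ↔ π.part i ∈ F := by
    intro F hF i
    constructor
    · rintro ⟨T, hT, hi⟩
      rwa [π.part_eq_of_mem (hF hT) hi]
    · intro h
      exact ⟨_, h, π.mem_part (Finset.mem_univ i)⟩
  constructor
  · rintro ⟨w, hw, F, hF, -, hQ⟩
    rcases hy.eq_or_eq_neg hw with rfl | rfl
    · refine ⟨fun T => decide (T ∈ F), ?_⟩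
      rw [flip_blockWord] at hQ
      simpa only [hpart hF] using hQ
    · refine ⟨fun T => !(decide (T ∈ F)), ?_⟩
      rw [not_blockWord, flip_blockWord] at hQ
      simpa only [hpart hF, Bool.not_xor, Bool.xor_not] using hQ
  · rintro ⟨o, ho⟩
    have hs : 0 < c.length := c.length_pos_iff.2 hr
    set T0 := π.part ⟨0, hs⟩
    -- Flipping the parts on which `o` differs from its value at the first part gives the desired
    -- word or its complement, according to `o T0`.
    have hF : π.parts.filter (fun T => o T ≠ o T0) ⊆ π.parts := Finset.filter_subset _ _
    have hF0 : ∀ T ∈ π.parts.filter (fun T => o T ≠ o T0), ∀ i ∈ T, i.1 ≠ 0 := by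
      intro T hT i hi h0
      rw [Finset.mem_filter] at hT
      apply hT.2
      congr 1
      rw [← π.part_eq_of_mem hT.1 hi]
      congr 1
      exact Fin.ext h0
    have hmem : ∀ i, (π.part i ∈ π.parts.filter (fun T => o T ≠ o T0)) ↔
        o (π.part i) ≠ o T0 := by
      intro i
      simp [π.part_mem]
    cases h0 : o T0
    · refine ⟨_, hy, _, hF, hF0, ?_⟩
      rw [flip_blockWord]
      simp only [hpart hF, hmem]
      simpa [h0] using ho
    · refine ⟨_, hy.neg, _, hF, hF0, ?_⟩
      rw [not_blockWord, flip_blockWord]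
      simp only [hpart hF, hmem]
      simpa [h0] using ho

/-- The bridge from patterns to comparisons: both bounds use the cube only through this statement.
-/
theorem exists_mem_cube_forms_iff (hr : 0 < r) {V : Type*} [LinearOrder V] {P : Pattern r}
    {c : Composition r} {y : Fin c.length → Bool} (hy : Represents (blockWord c y) P)
    (π : Finpartition (Finset.univ : Finset (Fin c.length))) {e f : Fin r → V}
    (he : StrictMono e) (hf : StrictMono f) (hd : ∀ a b, e a ≠ f b) :
    (∃ Q ∈ cube P c π, Forms (Finset.univ.image e) (Finset.univ.image f) Q) ↔
      ∃ o : Finset (Fin c.length) → Bool, ∀ a b,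
        e a < f b ↔ Precedes c (fun i => xor (y i) (o (π.part i))) a b := by
  constructor
  · rintro ⟨Q, hQ, hF⟩
    obtain ⟨o, ho⟩ := (mem_cube_iff hr hy π).1 hQ
    obtain ⟨w, hw, φ, h1, h2⟩ := forms_iff_exists_word.1 hF
    rcases ho.eq_or_eq_neg hw with rfl | rfl
    · exact ⟨o, (exists_orderEmbedding_iff he hf hd).1 ⟨φ, h1, h2⟩⟩
    · refine ⟨fun T => !(o T), ?_⟩
      simp only [Bool.xor_not]
      rw [not_blockWord] at h1 h2
      exact (exists_orderEmbedding_iff he hf hd).1 ⟨φ, h1, h2⟩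
  · rintro ⟨o, ho⟩
    obtain ⟨φ, h1, h2⟩ := (exists_orderEmbedding_iff he hf hd).2 ho
    refine ⟨blockPattern hr c _, (mem_cube_iff hr hy π).2 ⟨o, represents_blockPattern hr c _⟩,
      forms_iff_exists_word.2 ⟨_, represents_blockPattern hr c _, φ, h1, h2⟩⟩

end Patterns

/-! ### Existence and uniqueness of the composition -/

section Splitting

variable {r : ℕ}

/-- In every interleaving described by `R` the first `v` letters of each kind form a prefix. -/
def Cut (R : Fin r → Fin r → Prop) (v : ℕ) : Prop :=
  ∀ a b : Fin r, a.1 < v → v ≤ b.1 → R a b ∧ ¬ R b a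

/-- Inside a block the comparison does not depend on the two indices, so a cut strictly inside would
make it both true and false. -/
theorem cut_precedes_iff {c : Composition r} {y : Fin c.length → Bool} {v : ℕ} (hv : v ≤ r) :
    Cut (Precedes c y) v ↔ ∃ i ≤ c.length, c.sizeUpTo i = v := by
  constructor
  · intro h
    rcases hv.eq_or_lt with rfl | hv
    · exact ⟨c.length, le_rfl, c.sizeUpTo_length⟩
    refine ⟨c.index ⟨v, hv⟩, (c.index ⟨v, hv⟩).2.le, ?_⟩
    have h1 := c.sizeUpTo_index_le ⟨v, hv⟩
    have h2 := index_lt_add c ⟨v, hv⟩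
    simp only at h1 h2
    by_contra hne
    have hi : c.index ⟨v - 1, by omega⟩ = c.index ⟨v, hv⟩ :=
      index_eq_of_bounds c (by simp only; omega) (by simp only; omega)
    have := h ⟨v - 1, by omega⟩ ⟨v, hv⟩ (by simp only; omega) le_rfl
    simp [Precedes, hi] at this
  · rintro ⟨i, hi, rfl⟩ a b ha hb
    have h1 := c.sizeUpTo_index_le a
    have h2 : b.1 < c.sizeUpTo (c.index b + 1) := c.lt_sizeUpTo_index_succ b
    have hai : (c.index a).1 < i := by
      by_contra! hh
      have := c.monotone_sizeUpTo hh
      omega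
    have hbi : i ≤ (c.index b).1 := by
      by_contra! hh
      have := c.monotone_sizeUpTo (Nat.succ_le_of_lt hh)
      simp only [Nat.succ_eq_add_one] at this
      omega
    have hlt : c.index a < c.index b := by rw [Fin.lt_def]; omega
    exact ⟨Or.inl hlt, by simp [Precedes, hlt.not_gt, hlt.ne']⟩

theorem mem_boundaries_iff (c : Composition r) (v : Fin (r + 1)) :
    v ∈ c.boundaries ↔ ∃ i ≤ c.length, c.sizeUpTo i = v := by
  simp only [Composition.boundaries, Finset.mem_map, Finset.mem_univ, true_and]
  constructor
  · rintro ⟨i, rfl⟩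
    exact ⟨i, Nat.lt_succ_iff.1 i.2, rfl⟩
  · rintro ⟨i, hi, h⟩
    exact ⟨⟨i, Nat.lt_succ_iff.2 hi⟩, Fin.ext h⟩

/-- The pattern determines the relation `Precedes` (up to complementing the orientation), this
determines the cuts, and the cuts are the boundaries of the composition. -/
theorem IsSplitting.unique {P : Pattern r} {c c' : Composition r} (h : IsSplitting P c)
    (h' : IsSplitting P c') : c = c' := by
  obtain ⟨y, hy⟩ := isSplitting_iff.1 h
  obtain ⟨y', hy'⟩ : ∃ y', blockWord c' y' = blockWord c y := by
    obtain ⟨y', hy'⟩ := isSplitting_iff.1 h'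
    rcases hy.eq_or_eq_neg hy' with hh | hh
    · exact ⟨y', hh⟩
    · exact ⟨fun i => !(y' i), by rw [← not_blockWord, hh]; simp⟩
  have hpos : ∀ l, pos c y l = pos c' y' l := by
    intro l
    refine (StrictMono.range_inj (pos_strictMono c y l) (pos_strictMono c' y' l)).1 ?_
    have h1 := filter_blockWord c y l
    rw [← hy', filter_blockWord c' y' l] at h1
    have := congrArg (fun s : Finset (Fin (r * 2)) => (s : Set (Fin (r * 2)))) h1
    simpa using this.symm
  have hR : Precedes c y = Precedes c' y' := by
    funext a b
    rw [← pos_false_lt_pos_true, ← pos_false_lt_pos_true, hpos, hpos]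
  apply (compositionEquiv r).injective
  apply CompositionAsSet.ext
  change c.boundaries = c'.boundaries
  ext v
  rw [mem_boundaries_iff, mem_boundaries_iff, ← cut_precedes_iff (y := y) (Nat.lt_succ_iff.1 v.2),
    ← cut_precedes_iff (y := y') (Nat.lt_succ_iff.1 v.2), hR]

/-- Three increasing sequences, every two of which are interleaved as described by `R`. -/
structure Triple {V : Type*} [LinearOrder V] (R : Fin r → Fin r → Prop)
    (f₁ f₂ f₃ : Fin r → V) : Prop where
  mono₁ : StrictMono f₁
  mono₂ : StrictMono f₂
  mono₃ : StrictMono f₃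
  ne₁₂ : ∀ a b, f₁ a ≠ f₂ b
  ne₁₃ : ∀ a b, f₁ a ≠ f₃ b
  ne₂₃ : ∀ a b, f₂ a ≠ f₃ b
  lt₁₂ : ∀ a b, f₁ a < f₂ b ↔ R a b
  lt₁₃ : ∀ a b, f₁ a < f₃ b ↔ R a b
  lt₂₃ : ∀ a b, f₂ a < f₃ b ↔ R a b

/-- Reversing the order of the three edges turns blocks starting with `B` into blocks starting with
`A`, so only the latter case has to be analysed. -/
theorem Triple.reverse {V : Type*} [LinearOrder V] {R : Fin r → Fin r → Prop}
    {f₁ f₂ f₃ : Fin r → V} (h : Triple R f₁ f₂ f₃) :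
    Triple (fun a b => ¬ R b a) f₃ f₂ f₁ where
  mono₁ := h.mono₃
  mono₂ := h.mono₂
  mono₃ := h.mono₁
  ne₁₂ a b := (h.ne₂₃ b a).symm
  ne₁₃ a b := (h.ne₁₃ b a).symm
  ne₂₃ a b := (h.ne₁₂ b a).symm
  lt₁₂ a b := by
    rw [← h.lt₂₃, not_lt]; exact ⟨le_of_lt, fun hh => lt_of_le_of_ne hh (h.ne₂₃ b a).symm⟩
  lt₁₃ a b := by
    rw [← h.lt₁₃, not_lt]; exact ⟨le_of_lt, fun hh => lt_of_le_of_ne hh (h.ne₁₃ b a).symm⟩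
  lt₂₃ a b := by
    rw [← h.lt₁₂, not_lt]; exact ⟨le_of_lt, fun hh => lt_of_le_of_ne hh (h.ne₁₂ b a).symm⟩

/-- Starting from a cut `m` with the `m`-th `A` before the `m`-th `B`, follow the letters `A` that
still precede the `m`-th `B`; they number `v - m`. Transitivity along the three edges shows that the
block closes at `v`. -/
theorem Triple.exists_next_cut_of_rel {V : Type*} [LinearOrder V] {R : Fin r → Fin r → Prop}
    {f₁ f₂ f₃ : Fin r → V} (h : Triple R f₁ f₂ f₃) (m : Fin r) (hm : Cut R m) (hR : R m m) :
    ∃ v, m.1 < v ∧ v ≤ r ∧ Cut R v ∧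
      ∀ a b : Fin r, m ≤ a → a.1 < v → m ≤ b → b.1 < v → R a b := by
  have mono : ∀ {a b a' b'}, R a b → a' ≤ a → b ≤ b' → R a' b' := by
    intro a b a' b' hab ha hb
    rw [← h.lt₁₂] at hab ⊢
    exact ((h.mono₁.monotone ha).trans_lt hab).trans_le (h.mono₂.monotone hb)
  -- The alternative `v = r` covers the case in which all remaining letters `A` precede the `m`-th
  -- `B`.
  have hex : ∃ v, m.1 < v ∧ (v = r ∨ ∃ hv : v < r, ¬ R ⟨v, hv⟩ m) :=
    ⟨r, m.2, Or.inl rfl⟩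
  classical
  set v := Nat.find hex
  obtain ⟨hmv, hv⟩ := Nat.find_spec hex
  have hvr : v ≤ r := by
    rcases hv with h | ⟨h, -⟩
    · exact h.le
    · exact h.le
  have hlow : ∀ a : Fin r, m ≤ a → a.1 < v → R a m := by
    intro a hma hav
    rcases hma.eq_or_lt with rfl | hma
    · exact hR
    have := Nat.find_min hex hav
    by_contra hn
    exact this ⟨hma, Or.inr ⟨a.2, hn⟩⟩
  have hup : ∀ b : Fin r, v ≤ b.1 → ¬ R b m := by
    intro b hb hbm
    rcases hv with hv | ⟨hv, hn⟩
    · have := b.2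
      change v = r at hv
      omega
    · exact hn (mono hbm (show v ≤ b.1 from hb) le_rfl)
  refine ⟨v, hmv, hvr, ?_, ?_⟩
  · intro a b hav hvb
    rcases lt_or_ge a m with ham | ham
    · exact hm a b ham (hmv.le.trans hvb)
    · refine ⟨mono (hlow a ham hav) le_rfl (show m.1 ≤ b.1 from hmv.le.trans hvb), fun hba => ?_⟩
      -- A backward comparison would give `f₁ b < f₂ a < f₃ m`, hence `R b m` with `b ≥ v`, against
      -- the choice of `v`.
      have h1 := (h.lt₁₂ b a).2 hba
      have h2 := (h.lt₂₃ a m).2 (hlow a ham hav)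
      exact hup b hvb ((h.lt₁₃ b m).1 (h1.trans h2))
  · intro a b ha hav hb hbv
    exact mono (hlow a ha hav) le_rfl hb

theorem Triple.exists_next_cut {V : Type*} [LinearOrder V] {R : Fin r → Fin r → Prop}
    {f₁ f₂ f₃ : Fin r → V} (h : Triple R f₁ f₂ f₃) (m : Fin r) (hm : Cut R m) :
    ∃ v, m.1 < v ∧ v ≤ r ∧ Cut R v ∧ ∃ x : Bool,
      ∀ a b : Fin r, m ≤ a → a.1 < v → m ≤ b → b.1 < v → (R a b ↔ x = false) := by
  by_cases hR : R m m
  · obtain ⟨v, h1, h2, h3, h4⟩ := h.exists_next_cut_of_rel m hm hR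
    refine ⟨v, h1, h2, h3, false, fun a b ha ha' hb hb' => ?_⟩
    simpa using h4 a b ha ha' hb hb'
  · obtain ⟨v, h1, h2, h3, h4⟩ := h.reverse.exists_next_cut_of_rel m
      (fun a b ha hb => ⟨(hm a b ha hb).2, not_not.2 (hm a b ha hb).1⟩) hR
    refine ⟨v, h1, h2, fun a b ha hb => ⟨not_not.1 (h3 a b ha hb).2, (h3 a b ha hb).1⟩, true,
      fun a b ha ha' hb hb' => ?_⟩
    simpa using h4 b a hb hb' ha ha'

/-- The cuts of `R` serve as the boundaries of the composition; between consecutive cuts `R` is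
constant by `Triple.exists_next_cut`, and this constant is the orientation. -/
theorem Triple.exists_composition {V : Type*} [LinearOrder V] {R : Fin r → Fin r → Prop}
    {f₁ f₂ f₃ : Fin r → V} (h : Triple R f₁ f₂ f₃) :
    ∃ (c : Composition r) (y : Fin c.length → Bool), ∀ a b, R a b ↔ Precedes c y a b := by
  classical
  let s : CompositionAsSet r :=
    { boundaries := Finset.univ.filter (fun v => Cut R v.1)
      zero_mem := Finset.mem_filter.2 ⟨Finset.mem_univ _, fun a _ ha => absurd ha (Nat.not_lt_zero _)⟩
      getLast_mem := Finset.mem_filter.2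
        ⟨Finset.mem_univ _, fun _ b _ hb => absurd b.2 (not_lt.2 hb)⟩ }
  let c := s.toComposition
  have hc : c.boundaries = s.boundaries := s.toComposition_boundaries
  have hcut : ∀ v ≤ r, (Cut R v ↔ ∃ i ≤ c.length, c.sizeUpTo i = v) := by
    intro v hv
    rw [← mem_boundaries_iff c ⟨v, Nat.lt_succ_iff.2 hv⟩, hc]
    simp [s]
  have hhom : ∀ i : Fin c.length, ∃ x : Bool, ∀ a b : Fin r, c.index a = i → c.index b = i →
      (R a b ↔ x = false) := by
    intro i
    have hlt : c.sizeUpTo i < r :=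
      (c.sizeUpTo_strict_mono i.2).trans_le (c.sizeUpTo_le _)
    obtain ⟨v, h1, h2, h3, x, hx⟩ := h.exists_next_cut ⟨c.sizeUpTo i, hlt⟩
      ((hcut _ hlt.le).2 ⟨i, i.2.le, rfl⟩)
    -- `v` is itself a boundary beyond the start of block `i`, so the whole block lies below it.
    have hv : c.sizeUpTo (i + 1) ≤ v := by
      obtain ⟨j, hj, rfl⟩ := (hcut v h2).1 h3
      apply c.monotone_sizeUpTo
      by_contra! hji
      have := c.monotone_sizeUpTo (Nat.lt_succ_iff.1 hji)
      simp only at h1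
      omega
    have hb : ∀ a : Fin r, c.index a = i → c.sizeUpTo i ≤ a.1 ∧ a.1 < v := by
      rintro a rfl
      exact ⟨c.sizeUpTo_index_le a, (c.lt_sizeUpTo_index_succ a).trans_le hv⟩
    exact ⟨x, fun a b ha hb' => hx a b (hb a ha).1 (hb a ha).2 (hb b hb').1 (hb b hb').2⟩
  choose y hy using hhom
  refine ⟨c, y, fun a b => ?_⟩
  have hlt : ∀ a b : Fin r, c.index a < c.index b → R a b ∧ ¬ R b a := by
    intro a b hab
    have hle := c.sizeUpTo_le (c.index b)
    refine (hcut _ hle).2 ⟨c.index b, (c.index b).2.le, rfl⟩ a b ?_ (c.sizeUpTo_index_le b)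
    have := c.lt_sizeUpTo_index_succ a
    exact this.trans_le (c.monotone_sizeUpTo hab)
  unfold Precedes
  rcases lt_trichotomy (c.index a) (c.index b) with hab | hab | hab
  · simp [hab, (hlt a b hab).1]
  · simp [hab, hy (c.index b) a b hab rfl]
  · simp [hab.not_gt, hab.ne', (hlt b a hab).2]

theorem orderEmbOfFin_eq_of_map_eq {V W : Type*} [LinearOrder V] [LinearOrder W] {s : Finset V}
    {t : Finset W} {k : ℕ} (hs : s.card = k) (ht : t.card = k) (φ : V ↪o W)
    (h : s.map φ.toEmbedding = t) (a : Fin k) :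
    t.orderEmbOfFin ht a = φ (s.orderEmbOfFin hs a) := by
  have := Finset.orderEmbOfFin_unique ht (f := fun a => φ (s.orderEmbOfFin hs a)) (fun x => by
    rw [← h]; simp) (φ.strictMono.comp (s.orderEmbOfFin hs).strictMono)
  exact (congrFun this a).symm

theorem Represents.card_filter {w : Fin (r * 2) → Bool} {P : Pattern r} (h : Represents w P)
    (l : Bool) : (Finset.univ.filter (fun p => w p = l)).card = r := by
  have hP := P.2
  simp only [orderedMatchings, Finset.mem_filter, Finset.mem_univ, true_and] at hP
  apply hP.1.1
  unfold Represents at h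
  rw [h]
  cases l <;> simp

/-- A clique of size three suffices: ordered by first vertex, its edges form a `Triple` for the
interleaving of `P`. -/
theorem Collectable.exists_isSplitting (hr : 0 < r) {P : Pattern r} (hP : Collectable P) :
    ∃ c, IsSplitting P c := by
  -- With the word starting with `A`, the edge with the smaller first vertex always plays `A`.
  obtain ⟨w, hw, hw0⟩ : ∃ w, Represents w P ∧ w ⟨0, by omega⟩ = false := by
    obtain ⟨w, hw⟩ := exists_represents P
    cases h0 : w ⟨0, by omega⟩
    · exact ⟨w, hw, h0⟩
    · exact ⟨_, hw.neg, by simp [h0]⟩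
  obtain ⟨k, hk, K, hKm, hK⟩ := hP 3
  simp only [orderedMatchings, Finset.mem_filter, Finset.mem_univ, true_and] at hKm
  obtain ⟨⟨hcard, hdisj⟩, hKk⟩ := hKm
  have hfc := hw.card_filter
  set S : Bool → Fin r → Fin (r * 2) := fun l =>
    (Finset.univ.filter (fun p => w p = l)).orderEmbOfFin (hfc l) with hS
  have hSm : ∀ l a, w (S l a) = l := by
    intro l a
    exact (Finset.mem_filter.1
      (Finset.orderEmbOfFin_mem (Finset.univ.filter (fun p => w p = l)) (hfc l) a)).2
  set R : Fin r → Fin r → Prop := fun a b => S false a < S true b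
  let z : Fin r := ⟨0, hr⟩
  have hR0 : R z z := by
    have h1 : S false z ≤ ⟨0, by omega⟩ := by
      have hm : (⟨0, by omega⟩ : Fin (r * 2)) ∈
        (Finset.univ.filter (fun p => w p = false)) := by simp [hw0]
      rw [← Finset.mem_coe, ← Finset.range_orderEmbOfFin _ (hfc false)] at hm
      obtain ⟨a, ha⟩ := hm
      rw [← ha]
      exact ((Finset.univ.filter (fun p => w p = false)).orderEmbOfFin (hfc false)).monotone
        (show (0 : ℕ) ≤ a.1 from Nat.zero_le _)
    refine lt_of_le_of_lt h1 (lt_of_le_of_ne (Nat.zero_le _) ?_)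
    intro hh
    have := hSm true z
    rw [← hh, hw0] at this
    cases this
  let g : ∀ e : Finset (Fin (r * k)), e ∈ K → Fin r → Fin (r * k) := fun e he =>
    e.orderEmbOfFin (hcard e he)
  have hg : ∀ e he, StrictMono (g e he) := fun e he => (e.orderEmbOfFin (hcard e he)).strictMono
  have hgd : ∀ e he f hf, e ≠ f → ∀ a b, g e he a ≠ g f hf b := by
    intro e he f hf hef a b hab
    have h1 := e.orderEmbOfFin_mem (hcard e he) a
    have h2 := f.orderEmbOfFin_mem (hcard f hf) b
    change g e he a ∈ e at h1
    rw [hab] at h1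
    exact Finset.disjoint_left.1 (hdisj e he f hf hef) h1 h2
  have hgR : ∀ e he f hf, g e he z < g f hf z → ∀ a b, g e he a < g f hf b ↔ R a b := by
    intro e he f hf hlt
    have hef : e ≠ f := by rintro rfl; exact lt_irrefl _ hlt
    obtain ⟨Q, rfl, hQ⟩ := hK e he f hf hef
    obtain ⟨w', hw', φ, h1, h2⟩ := forms_iff_exists_word.1 hQ
    rcases hw.eq_or_eq_neg hw' with rfl | rfl
    · intro a b
      rw [show g e he a = _ from orderEmbOfFin_eq_of_map_eq (hfc false) (hcard e he) φ h1 a,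
        show g f hf b = _ from orderEmbOfFin_eq_of_map_eq (hfc true) (hcard f hf) φ h2 b]
      exact φ.lt_iff_lt
    · exfalso
      simp only [Bool.not_eq_false', Bool.not_eq_true'] at h1 h2
      rw [show g e he z = _ from orderEmbOfFin_eq_of_map_eq (hfc true) (hcard e he) φ h1 z,
        show g f hf z = _ from orderEmbOfFin_eq_of_map_eq (hfc false) (hcard f hf) φ h2 z] at hlt
      exact hlt.not_gt (φ.lt_iff_lt.2 hR0)
  have hinj : Function.Injective (fun e : K => g e.1 e.2 z) := by
    intro e f hef
    by_contra hne
    exact hgd e.1 e.2 f.1 f.2 (fun hh => hne (Subtype.ext hh)) z z hef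
  have hcard' : (Finset.univ.image (fun e : K => g e.1 e.2 z)).card = k := by
    rw [Finset.card_image_of_injective _ hinj]; simp [hKk]
  set ψ := (Finset.univ.image (fun e : K => g e.1 e.2 z)).orderEmbOfFin hcard'
  have hmem : ∀ i : Fin k, ∃ e : K, g e.1 e.2 z = ψ i := by
    intro i
    obtain ⟨e, -, he⟩ := Finset.mem_image.1
      ((Finset.univ.image (fun e : K => g e.1 e.2 z)).orderEmbOfFin_mem hcard' i)
    exact ⟨e, he⟩
  obtain ⟨e₁, h₁⟩ := hmem ⟨0, by omega⟩
  obtain ⟨e₂, h₂⟩ := hmem ⟨1, by omega⟩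
  obtain ⟨e₃, h₃⟩ := hmem ⟨2, by omega⟩
  have l₁₂ : g e₁.1 e₁.2 z < g e₂.1 e₂.2 z := by
    rw [h₁, h₂]; exact ψ.strictMono (by simp [Fin.lt_def])
  have l₂₃ : g e₂.1 e₂.2 z < g e₃.1 e₃.2 z := by
    rw [h₂, h₃]; exact ψ.strictMono (by simp [Fin.lt_def])
  have l₁₃ := l₁₂.trans l₂₃
  have hne : ∀ {e f : K}, g e.1 e.2 z < g f.1 f.2 z → e.1 ≠ f.1 := by
    intro e f h hh
    rw [Subtype.ext hh] at h
    exact lt_irrefl _ h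
  have hT : Triple R (g e₁.1 e₁.2) (g e₂.1 e₂.2) (g e₃.1 e₃.2) :=
    ⟨hg _ e₁.2, hg _ e₂.2, hg _ e₃.2, hgd _ e₁.2 _ e₂.2 (hne l₁₂), hgd _ e₁.2 _ e₃.2 (hne l₁₃),
      hgd _ e₂.2 _ e₃.2 (hne l₂₃),
      hgR _ e₁.2 _ e₂.2 l₁₂, hgR _ e₁.2 _ e₃.2 l₁₃, hgR _ e₂.2 _ e₃.2 l₂₃⟩
  obtain ⟨c, y, hcy⟩ := hT.exists_composition
  refine ⟨c, isSplitting_iff.2 ⟨y, ?_⟩⟩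
  have hSmono : ∀ l, StrictMono (S l) := fun l =>
    ((Finset.univ.filter (fun p => w p = l)).orderEmbOfFin (hfc l)).strictMono
  obtain ⟨φ, h1, h2⟩ := (exists_orderEmbedding_iff (c := c) (y := y) (hSmono false) (hSmono true)
    (fun a b hab => by
      have h1 := hSm false a
      have h2 := hSm true b
      rw [hab, h2] at h1
      cases h1)).2 hcy
  -- An order embedding of a finite chain into itself is the identity, so the block word is `w`
  -- itself.
  have hφ : (φ : Fin (r * 2) → Fin (r * 2)) = id := by
    refine (StrictMono.range_inj φ.strictMono strictMono_id).1 ?_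
    rw [Set.range_id, Set.range_eq_univ]
    exact Finite.surjective_of_injective φ.injective
  convert hw using 1
  funext p
  cases hp : blockWord c y p
  · have : p ∈ Finset.univ.image (S false) := by
      rw [← h1, Finset.mem_map]
      exact ⟨p, by simp [hp], congrFun hφ p⟩
    obtain ⟨a, -, rfl⟩ := Finset.mem_image.1 this
    exact (hSm false a).symm
  · have : p ∈ Finset.univ.image (S true) := by
      rw [← h2, Finset.mem_map]
      exact ⟨p, by simp [hp], congrFun hφ p⟩
    obtain ⟨a, -, rfl⟩ := Finset.mem_image.1 this
    exact (hSm true a).symm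

end Splitting

/-! ### Union bound, means and Chebyshev's inequality on a finite type -/

section UniformProbability

open Classical in
/-- The probability of an event for a uniformly random element of a finite type. -/
noncomputable def uprob {Ω : Type*} [Fintype Ω] (p : Ω → Prop) : ℝ :=
  ((Finset.univ.filter p).card : ℝ) / (Fintype.card Ω : ℝ)

variable {Ω : Type*} [Fintype Ω]

theorem uprob_eq (p : Ω → Prop) [DecidablePred p] :
    uprob p = ((Finset.univ.filter p).card : ℝ) / (Fintype.card Ω : ℝ) := by
  unfold uprob
  congr!

theorem uprob_mono {p q : Ω → Prop} (h : ∀ ω, p ω → q ω) : uprob p ≤ uprob q := by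
  classical
  rw [uprob_eq, uprob_eq]
  gcongr
  exact fun hp => h _ hp

theorem uprob_le_one (p : Ω → Prop) : uprob p ≤ 1 := by
  classical
  unfold uprob
  apply div_le_one_of_le₀ _ (Nat.cast_nonneg _)
  exact_mod_cast Finset.card_le_univ _

theorem one_sub_uprob_le [Nonempty Ω] {p q : Ω → Prop} (h : ∀ ω, ¬ p ω → q ω) :
    1 - uprob q ≤ uprob p := by
  classical
  have hpos : (0 : ℝ) < Fintype.card Ω := by exact_mod_cast Fintype.card_pos
  unfold uprob
  rw [sub_le_iff_le_add, ← add_div, le_div_iff₀ hpos, one_mul]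
  have : (Finset.univ : Finset Ω) ⊆ Finset.univ.filter p ∪ Finset.univ.filter q := by
    intro ω _
    by_cases hp : p ω
    · simp [hp]
    · simp [h ω hp]
  have h2 := (Finset.card_le_card this).trans (Finset.card_union_le _ _)
  rw [Finset.card_univ] at h2
  exact_mod_cast h2

theorem uprob_exists_le {ι : Type*} [Fintype ι] (p : ι → Ω → Prop) :
    uprob (fun ω => ∃ i, p i ω) ≤ ∑ i, uprob (p i) := by
  classical
  simp only [uprob_eq]
  rw [← Finset.sum_div]
  gcongr
  have : Finset.univ.filter (fun ω => ∃ i, p i ω)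
      ⊆ Finset.univ.biUnion (fun i => Finset.univ.filter (p i)) := by
    intro ω; simp
  exact_mod_cast (Finset.card_le_card this).trans Finset.card_biUnion_le

theorem uprob_or_le (p q : Ω → Prop) : uprob (fun ω => p ω ∨ q ω) ≤ uprob p + uprob q := by
  classical
  simp only [uprob_eq]
  rw [← add_div]
  gcongr
  rw [Finset.filter_or]
  exact_mod_cast Finset.card_union_le _ _

/-- The mean of a real function on a finite type. -/
noncomputable def mean (X : Ω → ℝ) : ℝ := (∑ ω, X ω) / (Fintype.card Ω : ℝ)

open Classical in
theorem uprob_eq_mean (p : Ω → Prop) : uprob p = mean (fun ω => if p ω then (1 : ℝ) else 0) := by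
  unfold uprob mean
  simp

theorem mean_mono {X Y : Ω → ℝ} (h : ∀ ω, X ω ≤ Y ω) : mean X ≤ mean Y := by
  unfold mean
  gcongr
  exact h _

theorem mean_add (X Y : Ω → ℝ) : mean (fun ω => X ω + Y ω) = mean X + mean Y := by
  unfold mean; rw [Finset.sum_add_distrib, add_div]

theorem mean_const_mul (a : ℝ) (X : Ω → ℝ) : mean (fun ω => a * X ω) = a * mean X := by
  unfold mean; rw [← Finset.mul_sum, mul_div_assoc]

theorem mean_sum {ι : Type*} (s : Finset ι) (X : ι → Ω → ℝ) :
    mean (fun ω => ∑ i ∈ s, X i ω) = ∑ i ∈ s, mean (X i) := by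
  unfold mean; rw [Finset.sum_comm, Finset.sum_div]

theorem mean_const [Nonempty Ω] (a : ℝ) : mean (fun _ : Ω => a) = a := by
  have hpos : (0 : ℝ) < Fintype.card Ω := by exact_mod_cast Fintype.card_pos
  unfold mean
  rw [Finset.sum_const, Finset.card_univ, nsmul_eq_mul]
  field_simp

theorem mean_sub_sq [Nonempty Ω] (X : Ω → ℝ) (m : ℝ) (hm : mean X = m) :
    mean (fun ω => (X ω - m) ^ 2) = mean (fun ω => X ω ^ 2) - m ^ 2 := by
  have : (fun ω => (X ω - m) ^ 2) = fun ω => X ω ^ 2 + ((-2 * m) * X ω + m ^ 2) := by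
    funext ω; ring
  rw [this, mean_add, mean_add, mean_const_mul, mean_const, hm]
  ring

/-- Chebyshev's inequality. -/
theorem uprob_le_of_sq [Nonempty Ω] (X : Ω → ℝ) {m ε : ℝ} (hm : mean X = m) (hε : 0 < ε) :
    uprob (fun ω => ε ≤ |X ω - m|) ≤ (mean (fun ω => X ω ^ 2) - m ^ 2) / ε ^ 2 := by
  classical
  rw [← mean_sub_sq X m hm, le_div_iff₀ (by positivity), mul_comm, uprob_eq_mean,
    ← mean_const_mul]
  apply mean_mono
  intro ω
  split_ifs with h
  · rw [mul_one, ← sq_abs (X ω - m)]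
    gcongr
  · rw [mul_zero]; positivity

end UniformProbability

/-! ### Restrictions of a random bijection -/

section RandomBijection

variable {α β κ : Type*} [Fintype α] [Fintype β] [Fintype κ] [DecidableEq α] [DecidableEq β]

theorem exists_perm_comp_eq (x x' : κ ↪ β) : ∃ ρ : Equiv.Perm β, ∀ i, ρ (x i) = x' i := by
  classical
  let e : {b // b ∈ Set.range x} ≃ {b // b ∈ Set.range x'} :=
    (Equiv.ofInjective x x.injective).symm.trans (Equiv.ofInjective x' x'.injective)
  refine ⟨e.extendSubtype, fun i => ?_⟩
  rw [e.extendSubtype_apply_of_mem _ ⟨i, rfl⟩]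
  simp only [e, Equiv.trans_apply]
  have : (Equiv.ofInjective x x.injective).symm ⟨x i, ⟨i, rfl⟩⟩ = i := by
    rw [Equiv.symm_apply_eq]; rfl
  rw [this]
  rfl

/-- A uniformly random bijection restricts to a uniformly random injection. -/
theorem uprob_restrict (j : κ ↪ α) (hαβ : Fintype.card α = Fintype.card β)
    (A : (κ → β) → Prop) [DecidablePred A] :
    uprob (fun σ : α ≃ β => A (fun u => σ (j u)))
      = ((Finset.univ.filter (fun x : κ ↪ β => A x)).card : ℝ) /
        ((Fintype.card β).descFactorial (Fintype.card κ) : ℝ) := by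
  classical
  let Φ : (α ≃ β) → (κ ↪ β) := fun σ => j.trans σ.toEmbedding
  obtain ⟨σ₀⟩ := Fintype.card_eq.1 hαβ
  let F := (Finset.univ.filter (fun σ => Φ σ = Φ σ₀)).card
  -- All fibres of the restriction map have the same size, because permutations of the target act
  -- transitively on injections.
  have hF : ∀ x, (Finset.univ.filter (fun σ => Φ σ = x)).card = F := by
    intro x
    obtain ⟨ρ, hρ⟩ := exists_perm_comp_eq x (Φ σ₀)
    refine Finset.card_bij (fun σ _ => σ.trans ρ) ?_ ?_ ?_
    · intro σ hσ
      simp only [Finset.mem_filter, Finset.mem_univ, true_and] at hσ ⊢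
      ext i
      rw [← hρ i, ← hσ]
      rfl
    · intro σ _ σ' _ h
      ext a
      exact ρ.injective (DFunLike.congr_fun h a)
    · intro σ hσ
      simp only [Finset.mem_filter, Finset.mem_univ, true_and] at hσ
      refine ⟨σ.trans ρ.symm, ?_, ?_⟩
      · simp only [Finset.mem_filter, Finset.mem_univ, true_and]
        ext i
        change ρ.symm (Φ σ i) = x i
        rw [hσ, ← hρ i, ρ.symm_apply_apply]
      · ext a; simp
  have hcount : ∀ B : (κ ↪ β) → Prop, (Finset.univ.filter (fun σ => B (Φ σ))).card
      = (Finset.univ.filter B).card * F := by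
    intro B
    rw [Finset.card_eq_sum_card_fiberwise (f := Φ) (t := Finset.univ.filter B)
      (fun σ hσ => by simpa using hσ), Finset.sum_const_nat]
    intro x hx
    rw [← hF x, Finset.filter_filter]
    congr 1
    ext σ
    simp only [Finset.mem_filter, Finset.mem_univ, true_and] at hx ⊢
    constructor
    · exact fun h => h.2
    · rintro rfl; exact ⟨hx, rfl⟩
  have htot : Fintype.card (α ≃ β)
      = (Fintype.card β).descFactorial (Fintype.card κ) * F := by
    have := hcount (fun _ => True)
    simpa [Fintype.card_embedding_eq] using this
  have hFpos : (F : ℝ) ≠ 0 := by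
    have : σ₀ ∈ Finset.univ.filter (fun σ => Φ σ = Φ σ₀) := by simp
    have := Finset.card_pos.2 ⟨σ₀, this⟩
    exact_mod_cast this.ne'
  rw [uprob_eq, htot]
  have h1 : (Finset.univ.filter (fun σ : α ≃ β => A (fun u => σ (j u)))).card
      = (Finset.univ.filter (fun x : κ ↪ β => A x)).card * F := by
    convert hcount (fun x => A x)
    rfl
  have h3 : ((Finset.univ.filter (fun σ : α ≃ β => A (fun u => σ (j u)))).card : ℝ)
      = ((Finset.univ.filter (fun x : κ ↪ β => A x)).card : ℝ) * F := by exact_mod_cast h1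
  push_cast
  rw [h3, mul_div_mul_right _ _ hFpos]

end RandomBijection

/-! ### Random matchings from random bijections -/

section RandomMatching

variable {r n : ℕ}

/-- The `i`-th edge of the matching described by the bijection `σ`. -/
def edgeOf (σ : Fin n × Fin r ≃ Fin (r * n)) (i : Fin n) : Finset (Fin (r * n)) :=
  Finset.univ.image (fun a => σ (i, a))

/-- The matching described by the bijection `σ`. -/
def matchingOf (σ : Fin n × Fin r ≃ Fin (r * n)) : Finset (Finset (Fin (r * n))) :=
  Finset.univ.image (edgeOf σ)

theorem card_edgeOf (σ : Fin n × Fin r ≃ Fin (r * n)) (i : Fin n) : (edgeOf σ i).card = r := by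
  unfold edgeOf
  rw [Finset.card_image_of_injective, Finset.card_univ, Fintype.card_fin]
  intro a b h
  simpa using h

theorem disjoint_edgeOf (σ : Fin n × Fin r ≃ Fin (r * n)) {i j : Fin n} (h : i ≠ j) :
    Disjoint (edgeOf σ i) (edgeOf σ j) := by
  rw [Finset.disjoint_left]
  intro v hi hj
  simp only [edgeOf, Finset.mem_image, Finset.mem_univ, true_and] at hi hj
  obtain ⟨a, rfl⟩ := hi
  obtain ⟨b, hb⟩ := hj
  have := σ.injective hb
  simp only [Prod.mk.injEq] at this
  exact h this.1.symm

theorem edgeOf_injective (hr : 0 < r) (σ : Fin n × Fin r ≃ Fin (r * n)) :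
    Function.Injective (edgeOf σ) := by
  intro i j h
  by_contra hne
  have := disjoint_edgeOf σ hne
  rw [h, disjoint_self, Finset.bot_eq_empty] at this
  have hc := card_edgeOf σ j
  rw [this] at hc
  simp at hc
  omega

theorem matchingOf_mem (hr : 0 < r) (σ : Fin n × Fin r ≃ Fin (r * n)) :
    matchingOf σ ∈ orderedMatchings r n := by
  simp only [orderedMatchings, Finset.mem_filter, Finset.mem_univ, true_and]
  simp only [matchingOf, IsMatching, Finset.mem_image, Finset.mem_univ, true_and]
  refine ⟨⟨?_, ?_⟩, ?_⟩
  · rintro _ ⟨i, rfl⟩; exact card_edgeOf σ i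
  · rintro _ ⟨i, rfl⟩ _ ⟨j, rfl⟩ hij
    exact disjoint_edgeOf σ (fun h => hij (by rw [h]))
  · rw [Finset.card_image_of_injective _ (edgeOf_injective hr σ)]; simp

theorem exists_matchingOf_eq {M : Finset (Finset (Fin (r * n)))} (hM : M ∈ orderedMatchings r n) :
    ∃ σ : Fin n × Fin r ≃ Fin (r * n), matchingOf σ = M := by
  simp only [orderedMatchings, Finset.mem_filter, Finset.mem_univ, true_and] at hM
  obtain ⟨⟨hc, hd⟩, hn⟩ := hM
  let E : Fin n ≃ M := (M.equivFinOfCardEq hn).symm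
  let g : Fin n × Fin r → Fin (r * n) := fun q =>
    (E q.1).1.orderEmbOfFin (hc _ (E q.1).2) q.2
  have hg : Function.Injective g := by
    rintro ⟨i, a⟩ ⟨j, b⟩ h
    have hi : g (i, a) ∈ (E i).1 := Finset.orderEmbOfFin_mem _ (hc _ (E i).2) a
    have hj : g (j, b) ∈ (E j).1 := Finset.orderEmbOfFin_mem _ (hc _ (E j).2) b
    obtain rfl : i = j := by
      by_contra hne
      have hne' : (E i).1 ≠ (E j).1 := fun hh => hne (E.injective (Subtype.ext hh))
      rw [h] at hi
      exact Finset.disjoint_left.1 (hd _ (E i).2 _ (E j).2 hne') hi hj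
    have : a = b := ((E i).1.orderEmbOfFin (hc _ (E i).2)).injective h
    rw [this]
  have hb : Function.Bijective g := by
    rw [Fintype.bijective_iff_injective_and_card]
    exact ⟨hg, by simp [mul_comm]⟩
  refine ⟨Equiv.ofBijective g hb, ?_⟩
  have he : ∀ i, edgeOf (Equiv.ofBijective g hb) i = (E i).1 := by
    intro i
    unfold edgeOf
    have := Finset.image_orderEmbOfFin_univ (E i).1 (hc _ (E i).2)
    rw [← this]
    rfl
  ext e
  simp only [matchingOf, Finset.mem_image, Finset.mem_univ, true_and, he]
  constructor
  · rintro ⟨i, rfl⟩; exact (E i).2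
  · intro h; exact ⟨E.symm ⟨e, h⟩, by simp⟩

theorem matchingOf_trans (σ : Fin n × Fin r ≃ Fin (r * n)) (ρ : Equiv.Perm (Fin (r * n))) :
    matchingOf (σ.trans ρ) = (matchingOf σ).image (fun e => e.image ρ) := by
  unfold matchingOf
  rw [Finset.image_image]
  congr 1
  funext i
  simp only [edgeOf, Function.comp, Finset.image_image]
  rfl

/-- The matching described by a uniformly random bijection is uniformly random. -/
theorem prob_eq_uprob (hr : 0 < r) (E : Finset (Finset (Fin (r * n))) → Prop) :
    prob r n E = uprob (fun σ : Fin n × Fin r ≃ Fin (r * n) => E (matchingOf σ)) := by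
  classical
  have hcard : Fintype.card (Fin n × Fin r) = Fintype.card (Fin (r * n)) := by simp [mul_comm]
  obtain ⟨σ₀⟩ := Fintype.card_eq.1 hcard
  let F := (Finset.univ.filter (fun σ => matchingOf σ = matchingOf σ₀)).card
  -- Relabelling the vertices by `σ₁⁻¹` followed by `σ₀` carries one fibre onto the other.
  have hF : ∀ M ∈ orderedMatchings r n,
      (Finset.univ.filter (fun σ => matchingOf σ = M)).card = F := by
    intro M hM
    obtain ⟨σ₁, rfl⟩ := exists_matchingOf_eq hM
    refine Finset.card_bij (fun σ _ => σ.trans (σ₁.symm.trans σ₀)) ?_ ?_ ?_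
    · intro σ hσ
      simp only [Finset.mem_filter, Finset.mem_univ, true_and] at hσ ⊢
      rw [matchingOf_trans, hσ, ← matchingOf_trans]
      congr 1
      ext; simp
    · intro σ _ σ' _ h
      refine Equiv.ext fun a => ?_
      simpa using DFunLike.congr_fun h a
    · intro σ hσ
      simp only [Finset.mem_filter, Finset.mem_univ, true_and] at hσ
      refine ⟨σ.trans (σ₀.symm.trans σ₁), ?_, ?_⟩
      · simp only [Finset.mem_filter, Finset.mem_univ, true_and]
        rw [matchingOf_trans, hσ, ← matchingOf_trans]
        congr 1
        ext; simp
      · ext a; simp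
  have hcount : ∀ B : Finset (Finset (Fin (r * n))) → Prop,
      (Finset.univ.filter (fun σ => B (matchingOf σ))).card
        = ((orderedMatchings r n).filter B).card * F := by
    intro B
    rw [Finset.card_eq_sum_card_fiberwise (f := matchingOf) (t := (orderedMatchings r n).filter B)
      (fun σ hσ => by
        simp only [Finset.coe_filter, Finset.mem_univ, true_and, Set.mem_ofPred_eq] at hσ ⊢
        exact ⟨matchingOf_mem hr σ, hσ⟩), Finset.sum_const_nat]
    intro M hM
    rw [Finset.mem_filter] at hM
    rw [← hF M hM.1, Finset.filter_filter]
    congr 1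
    ext σ
    simp only [Finset.mem_filter, Finset.mem_univ, true_and]
    constructor
    · exact fun h => h.2
    · rintro rfl; exact ⟨hM.2, rfl⟩
  have htot : Fintype.card (Fin n × Fin r ≃ Fin (r * n)) = (orderedMatchings r n).card * F := by
    have := hcount (fun _ => True)
    simpa using this
  have hFpos : (F : ℝ) ≠ 0 := by
    have : σ₀ ∈ Finset.univ.filter (fun σ => matchingOf σ = matchingOf σ₀) := by simp
    have := Finset.card_pos.2 ⟨σ₀, this⟩
    exact_mod_cast this.ne'
  unfold prob uprob
  rw [htot]
  have h1 := hcount E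
  push_cast
  rw [← mul_div_mul_right _ _ hFpos]
  congr 1
  symm
  convert (by exact_mod_cast h1 : ((Finset.univ.filter (fun σ => E (matchingOf σ))).card : ℝ)
      = (((orderedMatchings r n).filter E).card : ℝ) * F)

theorem le_maxClique_iff {V : Type*} [LinearOrder V] {S : Set (Pattern r)}
    {M : Finset (Finset V)} {k : ℕ} :
    k ≤ maxClique S M ↔ ∃ K ⊆ M, IsClique S K ∧ K.card = k := by
  classical
  unfold maxClique
  constructor
  · intro h
    have hne : (M.powerset.filter fun K => IsClique S K).Nonempty :=
      ⟨∅, by simp [IsClique]⟩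
    obtain ⟨K, hK, hmax⟩ := Finset.exists_mem_eq_sup _ hne Finset.card
    rw [Finset.mem_filter, Finset.mem_powerset] at hK
    rw [hmax] at h
    obtain ⟨K', hK', hc⟩ := Finset.exists_subset_card_eq h
    exact ⟨K', hK'.trans hK.1, fun e he f hf => hK.2 e (hK' he) f (hK' hf), hc⟩
  · rintro ⟨K, hKM, hK, rfl⟩
    exact Finset.le_sup (f := Finset.card) (by simpa using ⟨hKM, hK⟩)

end RandomMatching

/-! ### Upper bound by the first moment -/

section UpperBound

variable {r : ℕ}

/-- An injection with prescribed relative order is determined by its image. -/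
theorem card_embedding_lt_iff_le {κ : Type*} [Fintype κ] {L : ℕ} (O : κ → κ → Prop)
    [DecidablePred fun x : κ ↪ Fin L => ∀ p q, x p < x q ↔ O p q] :
    (Finset.univ.filter (fun x : κ ↪ Fin L => ∀ p q, x p < x q ↔ O p q)).card
      ≤ L.choose (Fintype.card κ) := by
  classical
  have h : L.choose (Fintype.card κ)
      = (Finset.powersetCard (Fintype.card κ) (Finset.univ : Finset (Fin L))).card := by
    simp
  rw [h]
  apply Finset.card_le_card_of_injOn (fun x => Finset.univ.map x)
  · intro x _
    simp
  · intro x hx y hy hxy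
    simp only [Finset.coe_filter, Finset.mem_univ, true_and, Set.mem_ofPred_eq] at hx hy
    apply DFunLike.coe_injective
    apply eq_of_range_eq_of_lt_iff x.injective
    · have := congrArg (fun s : Finset (Fin L) => (s : Set (Fin L))) hxy
      simpa using this
    · intro p q
      rw [hx, hy]

theorem exists_perm_orderEmbOfFin {V : Type*} [LinearOrder V] {k : ℕ} (f : Fin k → V)
    (hf : Function.Injective f) (hc : (Finset.univ.image f).card = k) :
    ∃ ρ : Equiv.Perm (Fin k), ∀ i, (Finset.univ.image f).orderEmbOfFin hc (ρ i) = f i := by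
  have h : ∀ i, ∃ j, (Finset.univ.image f).orderEmbOfFin hc j = f i := by
    intro i
    have hm : f i ∈ Finset.univ.image f := by simp
    rw [← Finset.mem_coe, ← Finset.range_orderEmbOfFin _ hc] at hm
    exact hm
  choose g hg using h
  have hgi : Function.Injective g := by
    intro i j hij
    apply hf
    rw [← hg i, ← hg j, hij]
  exact ⟨Equiv.ofBijective g (Finite.injective_iff_bijective.1 hgi), hg⟩

theorem exists_perm_lt_iff {V : Type*} [LinearOrder V] {k : ℕ} (f : Fin k → V)
    (hf : Function.Injective f) : ∃ ρ : Equiv.Perm (Fin k), ∀ i j, ρ i < ρ j ↔ f i < f j := by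
  have hc : (Finset.univ.image f).card = k := by
    rw [Finset.card_image_of_injective _ hf]; simp
  obtain ⟨ρ, hρ⟩ := exists_perm_orderEmbOfFin f hf hc
  refine ⟨ρ, fun i j => ?_⟩
  rw [← hρ i, ← hρ j, OrderEmbedding.lt_iff_lt]

/-- The relative order of the vertices of `k` edges forming a clique: `ρ T` is the order in which
the edges appear in the blocks of the part `T`, and `τ i` is the order of the vertices of the
`i`-th edge. -/
def CodeRel {k : ℕ} (c : Composition r) (y : Fin c.length → Bool)
    (π : Finpartition (Finset.univ : Finset (Fin c.length)))
    (ρ : Finset (Fin c.length) → Equiv.Perm (Fin k)) (τ : Fin k → Equiv.Perm (Fin r))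
    (p q : Fin k × Fin r) : Prop :=
  if p.1 = q.1 then τ p.1 p.2 < τ q.1 q.2
  else Precedes c (fun i => xor (y i) (decide (ρ (π.part i) q.1 < ρ (π.part i) p.1)))
    (τ p.1 p.2) (τ q.1 q.2)

theorem index_zero (hr : 0 < r) (c : Composition r) :
    c.index ⟨0, hr⟩ = ⟨0, c.length_pos_iff.2 hr⟩ :=
  index_eq_of_bounds c (by simp) (by simpa using Nat.lt_of_lt_of_le Nat.zero_lt_one (c.one_le_blocksFun _))

/-- Each part gets a representative position at which the order of the edges is read. For the part
of the first block it is position zero, so this order is that of the first vertices. -/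
theorem exists_index_part (hr : 0 < r) (c : Composition r)
    (π : Finpartition (Finset.univ : Finset (Fin c.length))) :
    ∃ a : Finset (Fin c.length) → Fin r, a (π.part ⟨0, c.length_pos_iff.2 hr⟩) = ⟨0, hr⟩ ∧
      ∀ T ∈ π.parts, π.part (c.index (a T)) = T := by
  classical
  have h : ∀ T, ∃ a : Fin r, T ∈ π.parts → π.part (c.index a) = T := by
    intro T
    by_cases hT : T ∈ π.parts
    · obtain ⟨i, hi⟩ := π.nonempty_of_mem_parts hT
      refine ⟨c.embedding i ⟨0, c.one_le_blocksFun i⟩, fun _ => ?_⟩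
      rw [c.index_embedding]
      exact π.part_eq_of_mem hT hi
    · exact ⟨⟨0, hr⟩, fun h => absurd h hT⟩
  choose a ha using h
  refine ⟨Function.update a (π.part ⟨0, c.length_pos_iff.2 hr⟩) ⟨0, hr⟩, by simp, ?_⟩
  intro T hT
  by_cases hT0 : T = π.part ⟨0, c.length_pos_iff.2 hr⟩
  · rw [hT0, Function.update_self, index_zero]
  · rw [Function.update_of_ne hT0]
    exact ha T hT

/-- The flip of a part for a pair of edges is visible at the representative position of that part,
so the order of the edges there determines all comparisons within the part. The orientation `y'`
depends neither on `σ` nor on `k`, and the trivial permutation at the first part is what saves a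
factor `k!`. -/
theorem exists_codeRel (hr : 0 < r) {P : Pattern r} {c : Composition r}
    {y : Fin c.length → Bool} (hy : Represents (blockWord c y) P)
    (π : Finpartition (Finset.univ : Finset (Fin c.length))) :
    ∃ y' : Fin c.length → Bool, ∀ {n k : ℕ} (σ : Fin n × Fin r ≃ Fin (r * n)),
      (∃ K ⊆ matchingOf σ, IsClique (cube P c π) K ∧ K.card = k) →
      ∃ (ι : Fin k ↪ Fin n) (ρ : Finset (Fin c.length) → Equiv.Perm (Fin k))
        (τ : Fin k → Equiv.Perm (Fin r)), ρ (π.part ⟨0, c.length_pos_iff.2 hr⟩) = 1 ∧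
        ∀ p q, σ (ι p.1, p.2) < σ (ι q.1, q.2) ↔ CodeRel c y' π ρ τ p q := by
  obtain ⟨a, ha0, ha⟩ := exists_index_part hr c π
  -- Orientation of a block relative to the representative block of its part.
  refine ⟨fun i => xor (y i) (y (c.index (a (π.part i)))), ?_⟩
  rintro n k σ ⟨K, hKM, hK, hKk⟩
  let z : Fin r := ⟨0, hr⟩
  let s : Fin n → Fin r → Fin (r * n) := fun i => (edgeOf σ i).orderEmbOfFin (card_edgeOf σ i)
  have hs : ∀ i, StrictMono (s i) := fun i =>
    ((edgeOf σ i).orderEmbOfFin (card_edgeOf σ i)).strictMono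
  have hse : ∀ i, Finset.univ.image (s i) = edgeOf σ i := fun i =>
    Finset.image_orderEmbOfFin_univ _ _
  have hsd : ∀ {i j}, i ≠ j → ∀ a b, s i a ≠ s j b := by
    intro i j hij a b hab
    have h1 : s i a ∈ edgeOf σ i := Finset.orderEmbOfFin_mem _ _ _
    have h2 : s j b ∈ edgeOf σ j := Finset.orderEmbOfFin_mem _ _ _
    rw [hab] at h1
    exact Finset.disjoint_left.1 (disjoint_edgeOf σ hij) h1 h2
  let I : Finset (Fin n) := Finset.univ.filter (fun i => edgeOf σ i ∈ K)
  have hIK : I.image (edgeOf σ) = K := by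
    ext e
    simp only [Finset.mem_image, I, Finset.mem_filter, Finset.mem_univ, true_and]
    constructor
    · rintro ⟨i, hi, rfl⟩; exact hi
    · intro he
      have := hKM he
      simp only [matchingOf, Finset.mem_image, Finset.mem_univ, true_and] at this
      obtain ⟨i, rfl⟩ := this
      exact ⟨i, he, rfl⟩
  have hI : I.card = k := by
    rw [← hKk, ← hIK, Finset.card_image_of_injective _ (edgeOf_injective hr σ)]
  have hfirst : Function.Injective (fun i => s i z) := by
    intro i j hij
    by_contra hne
    exact hsd hne z z hij
  have hcard : (I.image (fun i => s i z)).card = k := by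
    rw [Finset.card_image_of_injective _ hfirst, hI]
  -- The edges of the clique are enumerated in the order of their first vertices.
  have hex : ∀ u : Fin k, ∃ i ∈ I, s i z = (I.image (fun i => s i z)).orderEmbOfFin hcard u :=
    fun u => Finset.mem_image.1 (Finset.orderEmbOfFin_mem _ hcard u)
  choose ι hιI hι using hex
  have hιlt : ∀ u v, u < v ↔ s (ι u) z < s (ι v) z := by
    intro u v
    rw [hι, hι, OrderEmbedding.lt_iff_lt]
  have hιinj : Function.Injective ι := by
    intro u v huv
    by_contra hne
    rcases lt_or_gt_of_ne hne with h | h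
    · rw [hιlt, huv] at h; exact lt_irrefl _ h
    · rw [hιlt, huv] at h; exact lt_irrefl _ h
  have hρ : ∀ T, ∃ ρ : Equiv.Perm (Fin k), ∀ u v, ρ u < ρ v ↔ s (ι u) (a T) < s (ι v) (a T) := by
    intro T
    refine exists_perm_lt_iff _ ?_
    intro u v huv
    by_contra hne
    exact hsd (fun h => hne (hιinj h)) _ _ huv
  choose ρ₁ hρ₁ using hρ
  let T₀ := π.part ⟨0, c.length_pos_iff.2 hr⟩
  obtain ⟨ρ, hρ0, hρ⟩ : ∃ ρ : Finset (Fin c.length) → Equiv.Perm (Fin k), ρ T₀ = 1 ∧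
      ∀ T u v, ρ T u < ρ T v ↔ s (ι u) (a T) < s (ι v) (a T) := by
    classical
    refine ⟨Function.update ρ₁ T₀ 1, by simp, fun T u v => ?_⟩
    by_cases hT : T = T₀
    · subst hT
      rw [Function.update_self, ha0]
      exact hιlt u v
    · rw [Function.update_of_ne hT, hρ₁]
  have hτ : ∀ u : Fin k, ∃ τ : Equiv.Perm (Fin r), ∀ b, s (ι u) (τ b) = σ (ι u, b) := by
    intro u
    exact exists_perm_orderEmbOfFin (fun b => σ (ι u, b))
      (fun b b' h => by simpa using σ.injective h) (card_edgeOf σ (ι u))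
  choose τ hτ using hτ
  refine ⟨⟨ι, hιinj⟩, ρ, τ, hρ0, ?_⟩
  rintro ⟨u, b⟩ ⟨v, b'⟩
  simp only [Function.Embedding.coeFn_mk, CodeRel]
  rw [← hτ, ← hτ]
  split_ifs with huv
  · subst huv
    exact (hs _).lt_iff_lt
  · have hne : ι u ≠ ι v := fun h => huv (hιinj h)
    have hmem : ∀ u, edgeOf σ (ι u) ∈ K := fun u => (Finset.mem_filter.1 (hιI u)).2
    have hcl := hK _ (hmem u) _ (hmem v) (fun h => hne (edgeOf_injective hr σ h))
    rw [← hse, ← hse] at hcl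
    obtain ⟨o, ho⟩ :=
      (exists_mem_cube_forms_iff hr hy π (hs _) (hs _) (hsd hne)).1 hcl
    rw [ho]
    -- Comparing the two edges at the representative position recovers the unknown flip `o` from
    -- `ρ`.
    have key : ∀ i, xor (y i) (o (π.part i)) = xor (xor (y i) (y (c.index (a (π.part i)))))
        (decide (ρ (π.part i) v < ρ (π.part i) u)) := by
      intro i
      have h1 := ho (a (π.part i)) (a (π.part i))
      simp only [Precedes, lt_irrefl, true_and, false_or, ha _ (π.part_mem.2 (Finset.mem_univ i))] at h1
      have h2 : decide (ρ (π.part i) v < ρ (π.part i) u)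
          = xor (y (c.index (a (π.part i)))) (o (π.part i)) := by
        have h3 : ρ (π.part i) v < ρ (π.part i) u ↔
            ¬ s (ι u) (a (π.part i)) < s (ι v) (a (π.part i)) := by
          rw [hρ, not_lt]
          exact ⟨le_of_lt, fun hh => lt_of_le_of_ne hh (hsd hne _ _).symm⟩
        rw [h1] at h3
        simp only [h3]
        cases xor (y (c.index (a (π.part i)))) (o (π.part i)) <;> simp
      rw [h2]
      cases y i <;> cases y (c.index (a (π.part i))) <;> simp
    simp only [key]

open Classical in
/-- First moment bound for the number of cliques of size `k`. -/
theorem uprob_le_maxClique_le (hr : 0 < r) {P : Pattern r} {c : Composition r}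
    (hP : IsSplitting P c) (π : Finpartition (Finset.univ : Finset (Fin c.length))) {t : ℕ}
    (ht : π.parts.card = t + 1) (n k : ℕ) :
    uprob (fun σ : Fin n × Fin r ≃ Fin (r * n) => k ≤ maxClique (cube P c π) (matchingOf σ))
      ≤ (n : ℝ) ^ k * (k.factorial : ℝ) ^ t * (r.factorial : ℝ) ^ k / ((k * r).factorial : ℝ) := by
  obtain ⟨y, hy⟩ := isSplitting_iff.1 hP
  obtain ⟨y', hy'⟩ := exists_codeRel hr hy π
  let T₀ := π.part ⟨0, c.length_pos_iff.2 hr⟩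
  let U := {T // T ∈ π.parts.erase T₀}
  have hU : Fintype.card U = t := by
    rw [Fintype.card_coe, Finset.card_erase_of_mem (π.part_mem.2 (Finset.mem_univ _)), ht]
    rfl
  -- The identity is put on the part of the first block, so the union bound runs over `t`
  -- permutations only.
  let ext : (U → Equiv.Perm (Fin k)) → Finset (Fin c.length) → Equiv.Perm (Fin k) :=
    fun ρ T => if h : T ∈ π.parts.erase T₀ then ρ ⟨T, h⟩ else 1
  have hsub : ∀ σ : Fin n × Fin r ≃ Fin (r * n), k ≤ maxClique (cube P c π) (matchingOf σ) →
      ∃ q : (Fin k ↪ Fin n) × (U → Equiv.Perm (Fin k)) × (Fin k → Equiv.Perm (Fin r)),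
        ∀ u v : Fin k × Fin r, σ (q.1 u.1, u.2) < σ (q.1 v.1, v.2) ↔
          CodeRel c y' π (ext q.2.1) q.2.2 u v := by
    intro σ hσ
    obtain ⟨ι, ρ, τ, hρ, h⟩ := hy' σ (le_maxClique_iff.1 hσ)
    refine ⟨⟨ι, fun T => ρ T.1, τ⟩, fun u v => ?_⟩
    rw [h]
    have : ∀ i, ext (fun T => ρ T.1) (π.part i) = ρ (π.part i) := by
      intro i
      by_cases hi : π.part i = T₀
      · simp only [ext, hi, Finset.notMem_erase, dif_neg, not_false_iff]
        exact hρ.symm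
      · have : π.part i ∈ π.parts.erase T₀ :=
          Finset.mem_erase.2 ⟨hi, π.part_mem.2 (Finset.mem_univ _)⟩
        simp only [ext, dif_pos this]
    simp only [CodeRel, this]
  refine (uprob_mono hsub).trans ((uprob_exists_le _).trans ?_)
  -- For each code at most `(rn).choose (kr)` of the `(rn).descFactorial (kr)` injections have the
  -- required order; the quotient is `1 / (kr)!`.
  have hterm : ∀ q : (Fin k ↪ Fin n) × (U → Equiv.Perm (Fin k)) × (Fin k → Equiv.Perm (Fin r)),
      uprob (fun σ : Fin n × Fin r ≃ Fin (r * n) => ∀ u v : Fin k × Fin r,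
        σ (q.1 u.1, u.2) < σ (q.1 v.1, v.2) ↔ CodeRel c y' π (ext q.2.1) q.2.2 u v)
      ≤ 1 / ((k * r).factorial : ℝ) := by
    rintro ⟨ι, ρ, τ⟩
    let j : Fin k × Fin r ↪ Fin n × Fin r := ι.prodMap (Function.Embedding.refl _)
    have h1 := uprob_restrict j (β := Fin (r * n)) (by simp [mul_comm])
      (fun x => ∀ u v, x u < x v ↔ CodeRel c y' π (ext ρ) τ u v)
    refine h1.le.trans ?_
    have h2 := card_embedding_lt_iff_le (L := r * n) (CodeRel c y' π (ext ρ) τ)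
    have hkn : k * r ≤ r * n := by
      have := Fintype.card_le_of_embedding ι
      simp only [Fintype.card_fin] at this
      rw [mul_comm r n]
      exact Nat.mul_le_mul_right _ this
    rw [Fintype.card_prod, Fintype.card_fin, Fintype.card_fin] at h2
    rw [Fintype.card_prod, Fintype.card_fin, Fintype.card_fin, Fintype.card_fin,
      div_le_div_iff₀ (by exact_mod_cast Nat.descFactorial_pos.2 hkn) (by positivity), one_mul,
      Nat.descFactorial_eq_factorial_mul_choose]
    push_cast
    rw [mul_comm]
    gcongr
  refine (Finset.sum_le_sum fun q _ => hterm q).trans ?_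
  rw [Finset.sum_const, Finset.card_univ, Fintype.card_prod, Fintype.card_prod, Fintype.card_fun,
    Fintype.card_fun, Fintype.card_perm, Fintype.card_perm, hU, Fintype.card_embedding_eq]
  simp only [Fintype.card_fin, nsmul_eq_mul]
  push_cast
  rw [mul_one_div, ← mul_assoc]
  gcongr
  exact_mod_cast Nat.descFactorial_le_pow n k

/-- The left side over `k!` is one term of the exponential series at `k`, and `e < 3`. -/
theorem pow_le_three_pow_mul_factorial (k : ℕ) : (k : ℝ) ^ k ≤ 3 ^ k * (k.factorial : ℝ) := by
  have h1 : (k : ℝ) ^ k / (k.factorial : ℝ) ≤ Real.exp k :=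
    Real.pow_div_factorial_le_exp (k : ℝ) (Nat.cast_nonneg k) k
  have h2 : Real.exp k ≤ 3 ^ k := by
    rw [← mul_one (k : ℝ), Real.exp_nat_mul]
    gcongr
    exact Real.exp_one_lt_three.le
  rw [div_le_iff₀ (by positivity)] at h1
  exact h1.trans (by gcongr)

theorem factorial_pow_le (k r : ℕ) : k.factorial ^ r ≤ (k * r).factorial := by
  have := Nat.prod_factorial_dvd_factorial_sum (Finset.univ : Finset (Fin r)) (fun _ => k)
  simp only [Finset.prod_const, Finset.card_univ, Fintype.card_fin, Finset.sum_const,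
    smul_eq_mul] at this
  rw [mul_comm k r]
  exact Nat.le_of_dvd (Nat.factorial_pos _) this

/-- Since `(kr)! ≥ (k!)^r` and `k! ≥ (k/3)^k`, the ratio is at most the `k`-th power of `n r!
(3/k)^(r-t)`, and the hypothesis makes that base at most one half. -/
theorem first_moment_le {t n k : ℕ} (htr : t < r)
    (hk : 2 * (r.factorial : ℝ) * 3 ^ (r - t) * n ≤ (k : ℝ) ^ (r - t)) :
    (n : ℝ) ^ k * (k.factorial : ℝ) ^ t * (r.factorial : ℝ) ^ k / ((k * r).factorial : ℝ)
      ≤ (1 / 2) ^ k := by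
  obtain ⟨d, rfl⟩ := Nat.exists_eq_add_of_lt htr
  have hd : t + d + 1 - t = d + 1 := by omega
  rw [hd] at hk
  have hf : (k.factorial : ℝ) ^ (t + d + 1) ≤ ((k * (t + d + 1)).factorial : ℝ) := by
    exact_mod_cast factorial_pow_le k (t + d + 1)
  have hfp : (0 : ℝ) < k.factorial := by exact_mod_cast Nat.factorial_pos k
  have h1 : (2 * ((t + d + 1).factorial : ℝ) * 3 ^ (d + 1) * n) ^ k
      ≤ (3 ^ (d + 1)) ^ k * (k.factorial : ℝ) ^ (d + 1) := by
    calc (2 * ((t + d + 1).factorial : ℝ) * 3 ^ (d + 1) * n) ^ k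
        ≤ ((k : ℝ) ^ (d + 1)) ^ k := by gcongr
      _ = ((k : ℝ) ^ k) ^ (d + 1) := by rw [← pow_mul, ← pow_mul, mul_comm]
      _ ≤ (3 ^ k * (k.factorial : ℝ)) ^ (d + 1) := by
          gcongr; exact pow_le_three_pow_mul_factorial k
      _ = _ := by rw [mul_pow, ← pow_mul, ← pow_mul, mul_comm k]
  have h2 : 2 ^ k * ((n : ℝ) ^ k * ((t + d + 1).factorial : ℝ) ^ k)
      ≤ (k.factorial : ℝ) ^ (d + 1) := by
    have h3 : (0 : ℝ) < (3 ^ (d + 1)) ^ k := by positivity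
    refine le_of_mul_le_mul_left (le_trans (le_of_eq ?_) h1) h3
    simp only [mul_pow]
    ring
  rw [div_le_iff₀ (by positivity)]
  calc (n : ℝ) ^ k * (k.factorial : ℝ) ^ t * ((t + d + 1).factorial : ℝ) ^ k
      = (1 / 2) ^ k * (2 ^ k * ((n : ℝ) ^ k * ((t + d + 1).factorial : ℝ) ^ k))
          * (k.factorial : ℝ) ^ t := by
        rw [← mul_assoc ((1 / 2 : ℝ) ^ k), ← mul_pow]; norm_num; ring
    _ ≤ (1 / 2) ^ k * (k.factorial : ℝ) ^ (d + 1) * (k.factorial : ℝ) ^ t := by gcongr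
    _ = (1 / 2) ^ k * (k.factorial : ℝ) ^ (t + d + 1) := by
        rw [mul_assoc, ← pow_add]; congr 2; ring
    _ ≤ _ := by gcongr

end UpperBound

/-! ### Good edges and their conflicts -/

section GoodTuples

variable {r : ℕ}

/-- The index of the box that contains the `a`-th vertex of an edge whose coordinate in the
corresponding part is `j`. -/
def boxIndex (c : Composition r) (y : Fin c.length → Bool) {q : ℕ} (j : Fin q) (a : Fin r) : ℕ :=
  c.sizeUpTo (c.index a) * q
    + (if y (c.index a) = false then j else j.rev).1 * c.blocksFun (c.index a)
    + (a.1 - c.sizeUpTo (c.index a))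

/-- Geometry of the boxes: a block of size `l` owns `l * q` consecutive boxes, divided into `q`
groups of `l`. The coordinate of the part selects a group, counted from the right if the block
starts with `B`, and each of the `l` vertices has its own box in the group. -/
theorem boxIndex_lt (c : Composition r) (y : Fin c.length → Bool) {q : ℕ} (j : Fin q)
    (a : Fin r) :
    boxIndex c y j a < (c.sizeUpTo (c.index a) + c.blocksFun (c.index a)) * q := by
  unfold boxIndex
  have h1 := index_lt_add c a
  have h2 := c.sizeUpTo_index_le a
  set l := c.blocksFun (c.index a)
  set s := c.sizeUpTo (c.index a)
  have h3 := (if y (c.index a) = false then j else j.rev).2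
  set x := (if y (c.index a) = false then j else j.rev).1
  have h4 : (x + 1) * l ≤ q * l := Nat.mul_le_mul_right _ h3
  rw [add_mul] at *
  rw [mul_comm l q]
  omega

theorem boxIndex_lt_mul (c : Composition r) (y : Fin c.length → Bool) {q : ℕ} (j : Fin q)
    (a : Fin r) : boxIndex c y j a < r * q :=
  (boxIndex_lt c y j a).trans_le (Nat.mul_le_mul_right _ (sizeUpTo_add_le c _))

theorem le_boxIndex (c : Composition r) (y : Fin c.length → Bool) {q : ℕ} (j : Fin q)
    (a : Fin r) : c.sizeUpTo (c.index a) * q ≤ boxIndex c y j a := by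
  unfold boxIndex
  omega

theorem boxIndex_lt_of_index_lt (c : Composition r) (y : Fin c.length → Bool) {q : ℕ}
    (j j' : Fin q) {a b : Fin r} (h : c.index a < c.index b) :
    boxIndex c y j a < boxIndex c y j' b :=
  (boxIndex_lt c y j a).trans_le
    ((Nat.mul_le_mul_right _ (sizeUpTo_add_le_of_lt c h)).trans (le_boxIndex c y j' b))

/-- Because groups are counted backwards in blocks starting with `B`, comparing the coordinates of
one part fixes the orientation of all its blocks simultaneously. -/
theorem boxIndex_lt_of_coord_lt (c : Composition r) (y : Fin c.length → Bool) {q : ℕ}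
    {j j' : Fin q} {a b : Fin r} (h : c.index a = c.index b)
    (hj : xor (y (c.index a)) (decide (j' < j)) = false) (hne : j ≠ j') :
    boxIndex c y j a < boxIndex c y j' b := by
  have hlt : (if y (c.index a) = false then j else j.rev).1
      < (if y (c.index a) = false then j' else j'.rev).1 := by
    cases hy : y (c.index a)
    · simp only [hy, Bool.false_xor, decide_eq_false_iff_not, not_lt] at hj
      simpa using lt_of_le_of_ne hj hne
    · simp only [hy, Bool.true_xor, Bool.not_eq_false', decide_eq_true_eq] at hj
      exact Fin.rev_lt_rev.2 hj
  unfold boxIndex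
  rw [← h]
  have h1 := index_lt_add c a
  have h2 := c.sizeUpTo_index_le a
  set x := (if y (c.index a) = false then j else j.rev).1
  set x' := (if y (c.index a) = false then j' else j'.rev).1
  set l := c.blocksFun (c.index a)
  have h4 : (x + 1) * l ≤ x' * l := Nat.mul_le_mul_right _ hlt
  rw [add_mul] at h4
  omega

theorem boxIndex_lt_of_lt (c : Composition r) (y : Fin c.length → Bool) {q : ℕ}
    (j : Fin q) {a b : Fin r} (h : c.index a = c.index b) (hab : a < b) :
    boxIndex c y j a < boxIndex c y j b := by
  unfold boxIndex
  have h2 := c.sizeUpTo_index_le a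
  have h3 := c.sizeUpTo_index_le b
  have : a.1 < b.1 := hab
  rw [← h] at h3 ⊢
  omega

variable {c : Composition r} (y : Fin c.length → Bool)
  (π : Finpartition (Finset.univ : Finset (Fin c.length)))

/-- The part of the block that contains the position `a`. -/
def partOf (π : Finpartition (Finset.univ : Finset (Fin c.length))) (a : Fin r) :
    {T // T ∈ π.parts} :=
  ⟨π.part (c.index a), π.part_mem.2 (Finset.mem_univ _)⟩

theorem partOf_eq_of_index_eq {a b : Fin r} (h : c.index a = c.index b) :
    partOf π a = partOf π b := by
  simp only [partOf, h]

theorem partOf_surjective (hr : 0 < r) : Function.Surjective (partOf (r := r) π) := by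
  obtain ⟨a, -, ha⟩ := exists_index_part hr c π
  rintro ⟨T, hT⟩
  exact ⟨a T, Subtype.ext (ha T hT)⟩

/-- The increasing tuple of vertices described by the coordinates of the boxes and the offsets
inside the boxes. -/
def goodTuple {n q w : ℕ} (h : q * w ≤ n)
    (γ : ({T // T ∈ π.parts} → Fin q) × (Fin r → Fin w)) (a : Fin r) : Fin (r * n) :=
  ⟨boxIndex c y (γ.1 (partOf π a)) a * w + γ.2 a, by
    have h1 := boxIndex_lt_mul c y (γ.1 (partOf π a)) a
    have h2 := (γ.2 a).2
    calc boxIndex c y (γ.1 (partOf π a)) a * w + γ.2 a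
        < (boxIndex c y (γ.1 (partOf π a)) a + 1) * w := by rw [add_mul]; omega
      _ ≤ (r * q) * w := Nat.mul_le_mul_right _ h1
      _ = r * (q * w) := by ring
      _ ≤ r * n := Nat.mul_le_mul_left _ h⟩

variable {y π}

theorem goodTuple_lt_of_boxIndex_lt {n q w : ℕ} {h : q * w ≤ n}
    {γ γ' : ({T // T ∈ π.parts} → Fin q) × (Fin r → Fin w)} {a b : Fin r}
    (hlt : boxIndex c y (γ.1 (partOf π a)) a < boxIndex c y (γ'.1 (partOf π b)) b) :
    goodTuple y π h γ a < goodTuple y π h γ' b := by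
  rw [Fin.lt_def]
  simp only [goodTuple]
  have h1 := (γ.2 a).2
  have h2 : (boxIndex c y (γ.1 (partOf π a)) a + 1) * w
      ≤ boxIndex c y (γ'.1 (partOf π b)) b * w := Nat.mul_le_mul_right _ hlt
  rw [add_mul] at h2
  omega

theorem goodTuple_strictMono {n q w : ℕ} {h : q * w ≤ n}
    (γ : ({T // T ∈ π.parts} → Fin q) × (Fin r → Fin w)) :
    StrictMono (goodTuple y π h γ) := by
  intro a b hab
  apply goodTuple_lt_of_boxIndex_lt
  rcases (index_mono c hab.le).lt_or_eq with hi | hi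
  · exact boxIndex_lt_of_index_lt c y _ _ hi
  · rw [partOf_eq_of_index_eq π hi]
    exact boxIndex_lt_of_lt c y _ hi hab

theorem goodTuple_lt_of_precedes {n q w : ℕ} {h : q * w ≤ n}
    {γ γ' : ({T // T ∈ π.parts} → Fin q) × (Fin r → Fin w)} (hne : ∀ T, γ.1 T ≠ γ'.1 T)
    {a b : Fin r} (hab : c.index a < c.index b ∨ (c.index a = c.index b ∧
      xor (y (c.index a)) (decide (γ'.1 (partOf π a) < γ.1 (partOf π a))) = false)) :
    goodTuple y π h γ a < goodTuple y π h γ' b := by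
  apply goodTuple_lt_of_boxIndex_lt
  rcases hab with hi | ⟨hi, hx⟩
  · exact boxIndex_lt_of_index_lt c y _ _ hi
  · rw [← partOf_eq_of_index_eq π hi]
    exact boxIndex_lt_of_coord_lt c y hi hx (hne _)

/-- The right side is `Precedes` for `y` flipped on the parts where the second tuple has the smaller
coordinate. Distinct coordinates put the tuples into different groups, so offsets inside boxes play
no role. -/
theorem goodTuple_lt_iff {n q w : ℕ} {h : q * w ≤ n}
    {γ γ' : ({T // T ∈ π.parts} → Fin q) × (Fin r → Fin w)} (hne : ∀ T, γ.1 T ≠ γ'.1 T)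
    (a b : Fin r) : goodTuple y π h γ a < goodTuple y π h γ' b ↔
      (c.index a < c.index b ∨ (c.index a = c.index b ∧
        xor (y (c.index a)) (decide (γ'.1 (partOf π a) < γ.1 (partOf π a))) = false)) := by
  refine ⟨fun hlt => ?_, goodTuple_lt_of_precedes hne⟩
  by_contra hn
  refine hlt.not_gt (goodTuple_lt_of_precedes (fun T => (hne T).symm) ?_)
  rw [not_or, not_lt, not_and] at hn
  rcases hn.1.lt_or_eq with hi | hi
  · exact Or.inl hi
  · refine Or.inr ⟨hi, ?_⟩
    have h1 := hn.2 hi.symm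
    have h2 := hne (partOf π a)
    rw [partOf_eq_of_index_eq π hi, hi]
    have h3 : decide (γ.1 (partOf π a) < γ'.1 (partOf π a))
        = !(decide (γ'.1 (partOf π a) < γ.1 (partOf π a))) := by
      rcases lt_or_gt_of_ne h2 with h | h <;> simp [h, h.le]
    rw [h3]
    simpa using h1

theorem goodTuple_injective (hr : 0 < r) {n q w : ℕ} (h : q * w ≤ n) :
    Function.Injective (goodTuple y π h) := by
  intro γ γ' hγ
  have hval : ∀ a, boxIndex c y (γ.1 (partOf π a)) a * w + γ.2 a
      = boxIndex c y (γ'.1 (partOf π a)) a * w + γ'.2 a := fun a =>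
    congrArg Fin.val (congrFun hγ a)
  have hbox : ∀ a, boxIndex c y (γ.1 (partOf π a)) a = boxIndex c y (γ'.1 (partOf π a)) a := by
    intro a
    rcases lt_trichotomy (boxIndex c y (γ.1 (partOf π a)) a) (boxIndex c y (γ'.1 (partOf π a)) a)
      with hh | hh | hh
    · have := goodTuple_lt_of_boxIndex_lt (h := h) hh
      rw [hγ] at this
      exact absurd this (lt_irrefl _)
    · exact hh
    · have := goodTuple_lt_of_boxIndex_lt (h := h) hh
      rw [hγ] at this
      exact absurd this (lt_irrefl _)
  have h1 : γ.1 = γ'.1 := by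
    funext T
    obtain ⟨a, rfl⟩ := partOf_surjective π hr T
    by_contra hne
    by_cases hx : xor (y (c.index a)) (decide (γ'.1 (partOf π a) < γ.1 (partOf π a))) = false
    · exact (boxIndex_lt_of_coord_lt c y rfl hx hne).ne (hbox a)
    · refine (boxIndex_lt_of_coord_lt c y rfl ?_ (Ne.symm hne)).ne (hbox a).symm
      have h3 : decide (γ.1 (partOf π a) < γ'.1 (partOf π a))
          = !(decide (γ'.1 (partOf π a) < γ.1 (partOf π a))) := by
        rcases lt_or_gt_of_ne hne with h | h <;> simp [h, h.le]
      rw [h3]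
      simpa using hx
  refine Prod.ext h1 ?_
  funext a
  have := hval a
  rw [hbox a] at this
  exact Fin.ext (by omega)

variable (y π)

open Classical in
/-- The set of all good tuples. -/
noncomputable def goodTuples {n q w : ℕ} (h : q * w ≤ n) : Finset (Fin r → Fin (r * n)) :=
  Finset.univ.image (goodTuple y π h)

/-- Two disjoint good tuples are in conflict if they share a coordinate. -/
def Conflict {n q w : ℕ} (h : q * w ≤ n) (g g' : Fin r → Fin (r * n)) : Prop :=
  (∀ a b, g a ≠ g' b) ∧ ∃ γ γ', goodTuple y π h γ = g ∧ goodTuple y π h γ' = g' ∧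
    ∃ T, γ.1 T = γ'.1 T

variable {y π}

theorem Conflict.symm {n q w : ℕ} {h : q * w ≤ n} {g g' : Fin r → Fin (r * n)}
    (hc : Conflict y π h g g') : Conflict y π h g' g := by
  obtain ⟨hd, γ, γ', h1, h2, T, hT⟩ := hc
  exact ⟨fun a b => (hd b a).symm, γ', γ, h2, h1, T, hT.symm⟩

theorem Conflict.mem_left {n q w : ℕ} {h : q * w ≤ n} {g g' : Fin r → Fin (r * n)}
    (hc : Conflict y π h g g') : g ∈ goodTuples y π h := by
  obtain ⟨hd, γ, γ', rfl, h2, T, hT⟩ := hc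
  simp [goodTuples]

theorem card_goodTuples (hr : 0 < r) {t : ℕ} (ht : π.parts.card = t + 1) {n q w : ℕ}
    (h : q * w ≤ n) : (goodTuples y π h).card = q ^ (t + 1) * w ^ r := by
  unfold goodTuples
  rw [Finset.card_image_of_injective _ (goodTuple_injective hr h)]
  simp [ht]

theorem card_filter_apply_eq {ι : Type*} [Fintype ι] [DecidableEq ι] {q s : ℕ}
    (hι : Fintype.card ι = s + 1) (T : ι) (j : Fin q) :
    (Finset.univ.filter (fun f : ι → Fin q => f T = j)).card = q ^ s := by
  have h1 : Finset.univ.filter (fun f : ι → Fin q => f T = j)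
      = Fintype.piFinset (fun T' => if T' = T then {j} else Finset.univ) := by
    ext f
    simp only [Finset.mem_filter, Finset.mem_univ, true_and, Fintype.mem_piFinset]
    constructor
    · rintro rfl T'
      split_ifs with hT
      · simp [hT]
      · simp
    · intro hf
      simpa using hf T
  rw [h1, Fintype.card_piFinset, ← Finset.mul_prod_erase _ _ (Finset.mem_univ T),
    Finset.prod_congr rfl (g := fun _ => q) (fun x hx => by
      rw [if_neg (Finset.ne_of_mem_erase hx)]; simp)]
  simp [hι]

-- There are `t + 1` choices for the shared coordinate, and fixing it loses one factor `q` against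
-- the number of good tuples.
open Classical in
theorem card_conflict_le (hr : 0 < r) {t : ℕ} (ht : π.parts.card = t + 1) {n q w : ℕ}
    (h : q * w ≤ n) (g : Fin r → Fin (r * n)) :
    (Finset.univ.filter (fun g' => Conflict y π h g g')).card ≤ (t + 1) * (q ^ t * w ^ r) := by
  by_cases hg : ∃ γ, goodTuple y π h γ = g
  · obtain ⟨γ, rfl⟩ := hg
    have hsub : Finset.univ.filter (fun g' => Conflict y π h (goodTuple y π h γ) g') ⊆
        Finset.univ.biUnion (fun T : {T // T ∈ π.parts} =>
          ((Finset.univ.filter (fun J : {T // T ∈ π.parts} → Fin q => J T = γ.1 T)) ×ˢ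
            (Finset.univ : Finset (Fin r → Fin w))).image (goodTuple y π h)) := by
      intro g' hg'
      rw [Finset.mem_filter] at hg'
      obtain ⟨-, -, γ₁, γ', h1, rfl, T, hT⟩ := hg'
      obtain rfl := goodTuple_injective hr h h1
      simp only [Finset.mem_biUnion, Finset.mem_univ, true_and, Finset.mem_image]
      exact ⟨T, γ', by simp [hT], rfl⟩
    refine (Finset.card_le_card hsub).trans (Finset.card_biUnion_le.trans ?_)
    have hc : Fintype.card {T // T ∈ π.parts} = t + 1 := by simp [ht]
    have hle : ∀ T : {T // T ∈ π.parts},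
        (((Finset.univ.filter (fun J : {T // T ∈ π.parts} → Fin q => J T = γ.1 T)) ×ˢ
            (Finset.univ : Finset (Fin r → Fin w))).image (goodTuple y π h)).card
          ≤ q ^ t * w ^ r := by
      intro T
      refine Finset.card_image_le.trans (le_of_eq ?_)
      rw [Finset.card_product, card_filter_apply_eq hc]
      simp
    refine (Finset.sum_le_sum fun T _ => hle T).trans (le_of_eq ?_)
    rw [Finset.sum_const, Finset.card_univ, hc, smul_eq_mul]
  · rw [Finset.filter_false_of_mem]
    · simp
    · rintro g' - ⟨-, γ, -, h1, -⟩
      exact hg ⟨γ, h1⟩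

/-- Good edges without conflicts form a clique. -/
theorem card_le_maxClique (hr : 0 < r) {P : Pattern r} (hy : Represents (blockWord c y) P)
    {n q w : ℕ} (h : q * w ≤ n) (σ : Fin n × Fin r ≃ Fin (r * n)) (I : Finset (Fin n))
    (hI : ∀ i ∈ I, (fun a => σ (i, a)) ∈ goodTuples y π h)
    (hc : ∀ i ∈ I, ∀ j ∈ I, i ≠ j → ¬ Conflict y π h (fun a => σ (i, a)) (fun a => σ (j, a))) :
    I.card ≤ maxClique (cube P c π) (matchingOf σ) := by
  rw [le_maxClique_iff]
  refine ⟨I.image (edgeOf σ), ?_, ?_, Finset.card_image_of_injective _ (edgeOf_injective hr σ)⟩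
  · exact Finset.image_subset_image (Finset.subset_univ _)
  · intro e he f hf hef
    obtain ⟨i, hi, rfl⟩ := Finset.mem_image.1 he
    obtain ⟨j, hj, rfl⟩ := Finset.mem_image.1 hf
    have hij : i ≠ j := fun hh => hef (by rw [hh])
    have hd : ∀ a b, σ (i, a) ≠ σ (j, b) := by
      intro a b hab
      have := σ.injective hab
      simp only [Prod.mk.injEq] at this
      exact hij this.1
    obtain ⟨γ, -, hγ⟩ := Finset.mem_image.1 (hI i hi)
    obtain ⟨γ', -, hγ'⟩ := Finset.mem_image.1 (hI j hj)
    have hne : ∀ T, γ.1 T ≠ γ'.1 T := by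
      intro T hT
      exact hc i hi j hj hij ⟨hd, γ, γ', hγ, hγ', T, hT⟩
    have h1 : StrictMono (fun a => σ (i, a)) := by rw [← hγ]; exact goodTuple_strictMono γ
    have h2 : StrictMono (fun a => σ (j, a)) := by rw [← hγ']; exact goodTuple_strictMono γ'
    refine (exists_mem_cube_forms_iff hr hy π h1 h2 hd).2 ⟨fun T =>
      if hT : T ∈ π.parts then decide (γ'.1 ⟨T, hT⟩ < γ.1 ⟨T, hT⟩) else false, fun a b => ?_⟩
    have := goodTuple_lt_iff (h := h) (y := y) hne a b
    rw [hγ, hγ'] at this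
    rw [this]
    unfold Precedes partOf
    simp only [π.part_mem.2 (Finset.mem_univ _), dite_true]

end GoodTuples

/-! ### Probabilities of events about at most four edges -/

section Moments

variable {r n : ℕ}

theorem uprob_edges {m : ℕ} (h : Fin m → Fin n) (hh : Function.Injective h)
    (A : (Fin m → Fin r → Fin (r * n)) → Prop) [DecidablePred A] :
    uprob (fun σ : Fin n × Fin r ≃ Fin (r * n) => A (fun u a => σ (h u, a)))
      = ((Finset.univ.filter (fun f : Fin m × Fin r ↪ Fin (r * n) =>
          A (fun u a => f (u, a)))).card : ℝ) / ((r * n).descFactorial (m * r) : ℝ) := by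
  let j : Fin m × Fin r ↪ Fin n × Fin r :=
    Function.Embedding.prodMap ⟨h, hh⟩ (Function.Embedding.refl _)
  have h1 := uprob_restrict j (β := Fin (r * n)) (by simp [mul_comm])
    (fun f => A (fun u a => f (u, a)))
  simp only [Fintype.card_fin, Fintype.card_prod] at h1
  exact h1

/-- Non-injective families are counted as well. The surplus is harmless for upper bounds on second
moments, and the count factorises over the edges. -/
theorem uprob_edges_le {m : ℕ} (h : Fin m → Fin n) (hh : Function.Injective h)
    (A : (Fin m → Fin r → Fin (r * n)) → Prop) [DecidablePred A] :
    uprob (fun σ : Fin n × Fin r ≃ Fin (r * n) => A (fun u a => σ (h u, a)))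
      ≤ ((Finset.univ.filter A).card : ℝ) / ((r * n).descFactorial (m * r) : ℝ) := by
  rw [uprob_edges h hh A]
  gcongr
  refine Finset.card_le_card_of_injOn (fun f u a => f (u, a)) ?_ ?_
  · intro f hf
    simpa using hf
  · intro f _ g _ hfg
    ext ⟨u, a⟩
    exact congrArg Fin.val (congrFun (congrFun hfg u) a)

theorem uprob_edges_eq {m : ℕ} (h : Fin m → Fin n) (hh : Function.Injective h)
    (A : (Fin m → Fin r → Fin (r * n)) → Prop) [DecidablePred A]
    (hA : ∀ f, A f → Function.Injective (fun p : Fin m × Fin r => f p.1 p.2)) :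
    uprob (fun σ : Fin n × Fin r ≃ Fin (r * n) => A (fun u a => σ (h u, a)))
      = ((Finset.univ.filter A).card : ℝ) / ((r * n).descFactorial (m * r) : ℝ) := by
  rw [uprob_edges h hh A]
  congr 2
  refine Finset.card_bij (fun f _ u a => f (u, a)) ?_ ?_ ?_
  · intro f hf
    simpa using hf
  · intro f _ g _ hfg
    ext ⟨u, a⟩
    exact congrArg Fin.val (congrFun (congrFun hfg u) a)
  · intro f hf
    rw [Finset.mem_filter] at hf
    exact ⟨⟨fun p => f p.1 p.2, hA f hf.2⟩, by simpa using hf.2, rfl⟩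

/-- The vertices of the `i`-th edge. -/
def tuple (σ : Fin n × Fin r ≃ Fin (r * n)) (i : Fin n) : Fin r → Fin (r * n) := fun a => σ (i, a)

variable (G : Finset (Fin r → Fin (r * n)))
  (C : (Fin r → Fin (r * n)) → (Fin r → Fin (r * n)) → Prop) [DecidableRel C]

theorem uprob_tuple_mem (hG : ∀ g ∈ G, Function.Injective g) (i : Fin n) :
    uprob (fun σ : Fin n × Fin r ≃ Fin (r * n) => tuple σ i ∈ G)
      = (G.card : ℝ) / ((r * n).descFactorial r : ℝ) := by
  have h := uprob_edges_eq (m := 1) (r := r) ![i] (Function.injective_of_subsingleton _)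
    (fun f => f 0 ∈ G) (by
      rintro f hf ⟨u, a⟩ ⟨v, b⟩ hab
      obtain rfl := Subsingleton.elim u 0
      obtain rfl := Subsingleton.elim v 0
      exact Prod.ext rfl (hG _ hf hab))
  rw [one_mul] at h
  refine h.trans ?_
  congr 2
  refine Finset.card_bij (fun f _ => f 0) ?_ ?_ ?_
  · intro f hf; simpa using hf
  · intro f _ g _ hfg
    funext u
    rw [Subsingleton.elim u 0, hfg]
  · intro g hg
    exact ⟨fun _ => g, by simpa using hg, rfl⟩

theorem uprob_two_tuples_mem_le {i j : Fin n} (hij : i ≠ j) :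
    uprob (fun σ : Fin n × Fin r ≃ Fin (r * n) => tuple σ i ∈ G ∧ tuple σ j ∈ G)
      ≤ (G.card : ℝ) ^ 2 / ((r * n).descFactorial (2 * r) : ℝ) := by
  have h := uprob_edges_le (r := r) ![i, j] (by
    intro u v
    fin_cases u <;> fin_cases v <;> simp [hij, hij.symm]) (fun f => f 0 ∈ G ∧ f 1 ∈ G)
  refine h.trans ?_
  gcongr
  rw [sq]
  rw [← Nat.cast_mul, ← Finset.card_product]
  norm_cast
  refine Finset.card_le_card_of_injOn (fun f => (f 0, f 1)) ?_ ?_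
  · intro f hf; simpa using hf
  · intro f _ g _ hfg
    simp only [Prod.mk.injEq] at hfg
    funext u
    fin_cases u
    · exact hfg.1
    · exact hfg.2

/-- The number of ordered pairs of tuples in the relation `C`. -/
def pairCount : ℕ := (Finset.univ.filter (fun p : (Fin r → Fin (r * n)) × (Fin r → Fin (r * n)) =>
  C p.1 p.2)).card

variable {G C}

theorem pairCount_le (hC : ∀ g g', C g g' → g ∈ G) {D : ℕ}
    (hD : ∀ g, (Finset.univ.filter (C g)).card ≤ D) : pairCount C ≤ G.card * D := by
  unfold pairCount
  have hsub : Finset.univ.filter (fun p : (Fin r → Fin (r * n)) × (Fin r → Fin (r * n)) =>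
      C p.1 p.2) ⊆ (G.sigma (fun g => Finset.univ.filter (C g))).image
        (fun s => (s.1, s.2)) := by
    rintro ⟨g, g'⟩ hg
    simp only [Finset.mem_filter, Finset.mem_univ, true_and] at hg
    simp only [Finset.mem_image, Finset.mem_sigma, Finset.mem_filter, Finset.mem_univ, true_and]
    exact ⟨⟨g, g'⟩, ⟨hC _ _ hg, hg⟩, rfl⟩
  refine (Finset.card_le_card hsub).trans (Finset.card_image_le.trans ?_)
  rw [Finset.card_sigma]
  refine (Finset.sum_le_sum fun g _ => hD g).trans (le_of_eq ?_)
  rw [Finset.sum_const, smul_eq_mul]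

theorem uprob_conflict (hG : ∀ g ∈ G, Function.Injective g)
    (hC : ∀ g g', C g g' → g ∈ G) (hC' : ∀ g g', C g g' → g' ∈ G)
    (hCd : ∀ g g', C g g' → ∀ a b, g a ≠ g' b) {i j : Fin n} (hij : i ≠ j) :
    uprob (fun σ : Fin n × Fin r ≃ Fin (r * n) => C (tuple σ i) (tuple σ j))
      = (pairCount C : ℝ) / ((r * n).descFactorial (2 * r) : ℝ) := by
  have h := uprob_edges_eq (r := r) ![i, j] (by
    intro u v
    fin_cases u <;> fin_cases v <;> simp [hij, hij.symm]) (fun f => C (f 0) (f 1)) (by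
      rintro f hf ⟨u, a⟩ ⟨v, b⟩ hab
      have h0 := hG _ (hC _ _ hf)
      have h1 := hG _ (hC' _ _ hf)
      have hd := hCd _ _ hf
      simp only at hab
      fin_cases u <;> fin_cases v
      · rw [h0 hab]
      · exact absurd hab (hd a b)
      · exact absurd hab.symm (hd b a)
      · rw [h1 hab])
  refine h.trans ?_
  congr 2
  refine Finset.card_bij (fun f _ => (f 0, f 1)) ?_ ?_ ?_
  · intro f hf; simpa using hf
  · intro f _ g _ hfg
    simp only [Prod.mk.injEq] at hfg
    funext u
    fin_cases u
    · exact hfg.1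
    · exact hfg.2
  · rintro ⟨g, g'⟩ hg
    exact ⟨![g, g'], by simpa using hg, rfl⟩

/-- Choose the common tuple in `G`, then each of its two neighbours in at most `D` ways. -/
theorem uprob_conflict_path_le (hC : ∀ g g', C g g' → g ∈ G) {D : ℕ}
    (hD : ∀ g, (Finset.univ.filter (C g)).card ≤ D) {i j k : Fin n} (hij : i ≠ j) (hik : i ≠ k)
    (hjk : j ≠ k) :
    uprob (fun σ : Fin n × Fin r ≃ Fin (r * n) =>
        C (tuple σ i) (tuple σ j) ∧ C (tuple σ i) (tuple σ k))
      ≤ (G.card : ℝ) * (D : ℝ) ^ 2 / ((r * n).descFactorial (3 * r) : ℝ) := by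
  have h := uprob_edges_le (r := r) ![i, j, k] (by
    intro u v
    fin_cases u <;> fin_cases v <;> simp [hij, hij.symm, hik, hik.symm, hjk, hjk.symm])
    (fun f => C (f 0) (f 1) ∧ C (f 0) (f 2))
  refine h.trans ?_
  gcongr
  have hle : (Finset.univ.filter (fun f : Fin 3 → Fin r → Fin (r * n) =>
      C (f 0) (f 1) ∧ C (f 0) (f 2))).card
      ≤ (G.sigma (fun g => Finset.univ.filter (C g) ×ˢ Finset.univ.filter (C g))).card := by
    refine Finset.card_le_card_of_injOn (fun f => ⟨f 0, (f 1, f 2)⟩) ?_ ?_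
    · intro f hf
      simp only [Finset.coe_filter, Finset.mem_univ, true_and, Set.mem_ofPred_eq] at hf
      simp only [Finset.mem_coe, Finset.mem_sigma, Finset.mem_product, Finset.mem_filter,
        Finset.mem_univ, true_and]
      exact ⟨hC _ _ hf.1, hf⟩
    · intro f _ g _ hfg
      simp only [Sigma.mk.injEq, heq_eq_eq, Prod.mk.injEq] at hfg
      funext u
      fin_cases u
      · exact hfg.1
      · exact hfg.2.1
      · exact hfg.2.2
  have hle2 : (G.sigma (fun g => Finset.univ.filter (C g) ×ˢ Finset.univ.filter (C g))).card
      ≤ G.card * D ^ 2 := by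
    rw [Finset.card_sigma]
    refine (Finset.sum_le_sum fun g _ => ?_).trans (le_of_eq (by rw [Finset.sum_const, smul_eq_mul]))
    rw [Finset.card_product, sq]
    exact Nat.mul_le_mul (hD g) (hD g)
  exact_mod_cast hle.trans hle2

theorem uprob_conflict_conflict_le {i j k l : Fin n} (hij : i ≠ j) (hik : i ≠ k) (hil : i ≠ l)
    (hjk : j ≠ k) (hjl : j ≠ l) (hkl : k ≠ l) :
    uprob (fun σ : Fin n × Fin r ≃ Fin (r * n) =>
        C (tuple σ i) (tuple σ j) ∧ C (tuple σ k) (tuple σ l))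
      ≤ (pairCount C : ℝ) ^ 2 / ((r * n).descFactorial (4 * r) : ℝ) := by
  have h := uprob_edges_le (r := r) ![i, j, k, l] (by
    intro u v
    fin_cases u <;> fin_cases v <;> simp [hij, hij.symm, hik, hik.symm, hjk, hjk.symm,
      hil, hil.symm, hjl, hjl.symm, hkl, hkl.symm])
    (fun f => C (f 0) (f 1) ∧ C (f 2) (f 3))
  refine h.trans ?_
  gcongr
  rw [sq]
  unfold pairCount
  rw [← Nat.cast_mul, ← Finset.card_product]
  norm_cast
  refine Finset.card_le_card_of_injOn (fun f => ((f 0, f 1), (f 2, f 3))) ?_ ?_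
  · intro f hf; simpa using hf
  · intro f _ g _ hfg
    simp only [Prod.mk.injEq] at hfg
    funext u
    fin_cases u
    · exact hfg.1.1
    · exact hfg.1.2
    · exact hfg.2.1
    · exact hfg.2.2

end Moments

/-! ### First and second moments of the two counts -/

section Counts

variable {r n : ℕ} (G : Finset (Fin r → Fin (r * n)))
  (C : (Fin r → Fin (r * n)) → (Fin r → Fin (r * n)) → Prop) [DecidableRel C]
  (I : Finset (Fin n))

open Classical in
/-- The number of edges with index in `I` that lie in `G`. -/
noncomputable def goodCount (σ : Fin n × Fin r ≃ Fin (r * n)) : ℝ :=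
  ∑ i ∈ I, if tuple σ i ∈ G then 1 else 0

/-- The number of ordered pairs of distinct edges with index in `I` that are in the
relation `C`. -/
noncomputable def conflictCount (σ : Fin n × Fin r ≃ Fin (r * n)) : ℝ :=
  ∑ p ∈ I.offDiag, if C (tuple σ p.1) (tuple σ p.2) then 1 else 0

instance nonempty_bijection : Nonempty (Fin n × Fin r ≃ Fin (r * n)) :=
  Fintype.card_eq.1 (by simp [mul_comm])

variable {G C}

theorem mean_goodCount (hG : ∀ g ∈ G, Function.Injective g) :
    mean (goodCount G I) = I.card * ((G.card : ℝ) / ((r * n).descFactorial r : ℝ)) := by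
  classical
  unfold goodCount
  rw [mean_sum]
  have : ∀ i ∈ I, mean (fun σ : Fin n × Fin r ≃ Fin (r * n) =>
      if tuple σ i ∈ G then (1 : ℝ) else 0) = (G.card : ℝ) / ((r * n).descFactorial r : ℝ) := by
    intro i _
    rw [← uprob_tuple_mem G hG i, uprob_eq_mean]
    congr!
  rw [Finset.sum_congr rfl this, Finset.sum_const, nsmul_eq_mul]

theorem mean_goodCount_sq_le (hG : ∀ g ∈ G, Function.Injective g) :
    mean (fun σ => goodCount G I σ ^ 2)
      ≤ I.card * ((G.card : ℝ) / ((r * n).descFactorial r : ℝ))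
        + (I.card : ℝ) ^ 2 * ((G.card : ℝ) ^ 2 / ((r * n).descFactorial (2 * r) : ℝ)) := by
  classical
  set p₁ := (G.card : ℝ) / ((r * n).descFactorial r : ℝ) with hp₁
  set p₂ := (G.card : ℝ) ^ 2 / ((r * n).descFactorial (2 * r) : ℝ) with hp₂
  have h₂ : 0 ≤ p₂ := by positivity
  have hsq : (fun σ => goodCount G I σ ^ 2) = fun σ : Fin n × Fin r ≃ Fin (r * n) =>
      ∑ i ∈ I, ∑ j ∈ I, if tuple σ i ∈ G ∧ tuple σ j ∈ G then (1 : ℝ) else 0 := by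
    funext σ
    unfold goodCount
    rw [sq, Finset.sum_mul_sum]
    refine Finset.sum_congr rfl fun i _ => Finset.sum_congr rfl fun j _ => ?_
    by_cases h1 : tuple σ i ∈ G <;> by_cases h2 : tuple σ j ∈ G <;> simp [h1, h2]
  have hterm : ∀ i ∈ I, ∀ j ∈ I, mean (fun σ : Fin n × Fin r ≃ Fin (r * n) =>
      if tuple σ i ∈ G ∧ tuple σ j ∈ G then (1 : ℝ) else 0) ≤ (if i = j then p₁ else 0) + p₂ := by
    intro i _ j _
    have hu := uprob_eq_mean (fun σ : Fin n × Fin r ≃ Fin (r * n) =>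
      tuple σ i ∈ G ∧ tuple σ j ∈ G)
    have : mean (fun σ : Fin n × Fin r ≃ Fin (r * n) =>
      if tuple σ i ∈ G ∧ tuple σ j ∈ G then (1 : ℝ) else 0) = uprob
        (fun σ : Fin n × Fin r ≃ Fin (r * n) => tuple σ i ∈ G ∧ tuple σ j ∈ G) := by
      rw [hu]; congr!
    rw [this]
    split_ifs with hij
    · subst hij
      simp only [and_self]
      rw [uprob_tuple_mem G hG]
      linarith
    · rw [zero_add]
      exact uprob_two_tuples_mem_le G hij
  rw [hsq, mean_sum]
  have : ∀ i ∈ I, mean (fun σ : Fin n × Fin r ≃ Fin (r * n) =>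
      ∑ j ∈ I, if tuple σ i ∈ G ∧ tuple σ j ∈ G then (1 : ℝ) else 0) ≤ p₁ + I.card * p₂ := by
    intro i hi
    rw [mean_sum]
    refine (Finset.sum_le_sum fun j hj => hterm i hi j hj).trans (le_of_eq ?_)
    rw [Finset.sum_add_distrib, Finset.sum_ite_eq, if_pos hi, Finset.sum_const, nsmul_eq_mul]
  refine (Finset.sum_le_sum this).trans (le_of_eq ?_)
  rw [Finset.sum_const, nsmul_eq_mul]
  ring

theorem mean_conflict (i j k l : Fin n) :
    mean (fun σ : Fin n × Fin r ≃ Fin (r * n) =>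
      (if C (tuple σ i) (tuple σ j) then (1 : ℝ) else 0) *
      (if C (tuple σ k) (tuple σ l) then (1 : ℝ) else 0)) =
    uprob (fun σ : Fin n × Fin r ≃ Fin (r * n) =>
      C (tuple σ i) (tuple σ j) ∧ C (tuple σ k) (tuple σ l)) := by
  rw [uprob_eq_mean]
  congr 1
  funext σ
  by_cases h1 : C (tuple σ i) (tuple σ j) <;> by_cases h2 : C (tuple σ k) (tuple σ l) <;>
    simp [h1, h2]

theorem mean_conflictCount (hG : ∀ g ∈ G, Function.Injective g)
    (hC : ∀ g g', C g g' → g ∈ G) (hC' : ∀ g g', C g g' → g' ∈ G)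
    (hCd : ∀ g g', C g g' → ∀ a b, g a ≠ g' b) :
    mean (conflictCount C I)
      = I.offDiag.card * ((pairCount C : ℝ) / ((r * n).descFactorial (2 * r) : ℝ)) := by
  unfold conflictCount
  rw [mean_sum]
  have : ∀ p ∈ I.offDiag, mean (fun σ : Fin n × Fin r ≃ Fin (r * n) =>
      if C (tuple σ p.1) (tuple σ p.2) then (1 : ℝ) else 0)
      = (pairCount C : ℝ) / ((r * n).descFactorial (2 * r) : ℝ) := by
    intro p hp
    rw [← uprob_conflict hG hC hC' hCd (Finset.mem_offDiag.1 hp).2.2, uprob_eq_mean]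
    congr!
  rw [Finset.sum_congr rfl this, Finset.sum_const, nsmul_eq_mul]

/-- For a fixed ordered pair, the second pair is either disjoint from it, shares one edge with it
(at most `4 |I|` pairs), or equals it up to order (two pairs). -/
theorem mean_conflictCount_sq_le (hG : ∀ g ∈ G, Function.Injective g)
    (hC : ∀ g g', C g g' → g ∈ G) (hCs : ∀ g g', C g g' → C g' g)
    (hCd : ∀ g g', C g g' → ∀ a b, g a ≠ g' b) {D : ℕ}
    (hD : ∀ g, (Finset.univ.filter (C g)).card ≤ D) :
    mean (fun σ => conflictCount C I σ ^ 2)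
      ≤ I.offDiag.card *
        (I.offDiag.card * ((pairCount C : ℝ) ^ 2 / ((r * n).descFactorial (4 * r) : ℝ))
        + 4 * I.card * ((G.card : ℝ) * (D : ℝ) ^ 2 / ((r * n).descFactorial (3 * r) : ℝ))
        + 2 * ((G.card : ℝ) * (D : ℝ) / ((r * n).descFactorial (2 * r) : ℝ))) := by
  classical
  set B₄ := (pairCount C : ℝ) ^ 2 / ((r * n).descFactorial (4 * r) : ℝ) with hB₄
  set B₃ := (G.card : ℝ) * (D : ℝ) ^ 2 / ((r * n).descFactorial (3 * r) : ℝ) with hB₃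
  set B₂ := (G.card : ℝ) * (D : ℝ) / ((r * n).descFactorial (2 * r) : ℝ) with hB₂
  have h₄ : 0 ≤ B₄ := by positivity
  have h₃ : 0 ≤ B₃ := by positivity
  have h₂ : 0 ≤ B₂ := by positivity
  have hsymm : ∀ g g', C g g' ↔ C g' g := fun g g' => ⟨hCs g g', hCs g' g⟩
  have hpair : ∀ {i j : Fin n}, i ≠ j → uprob (fun σ : Fin n × Fin r ≃ Fin (r * n) =>
      C (tuple σ i) (tuple σ j)) ≤ B₂ := by
    intro i j hij
    rw [uprob_conflict hG hC (fun g g' h => hC _ _ (hCs _ _ h)) hCd hij, hB₂]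
    gcongr
    exact_mod_cast pairCount_le hC hD
  -- The case distinction is written as a sum of nonnegative indicator terms; the terms overlap, but
  -- each of them is easy to sum over `p'`.
  have hterm : ∀ p ∈ I.offDiag, ∀ p' ∈ I.offDiag,
      mean (fun σ : Fin n × Fin r ≃ Fin (r * n) =>
        (if C (tuple σ p.1) (tuple σ p.2) then (1 : ℝ) else 0) *
        (if C (tuple σ p'.1) (tuple σ p'.2) then (1 : ℝ) else 0)) ≤
      B₄ + (((if p'.1 = p.1 then B₃ else 0) + (if p'.1 = p.2 then B₃ else 0))
        + ((if p'.2 = p.1 then B₃ else 0) + (if p'.2 = p.2 then B₃ else 0)))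
      + ((if p' = p then B₂ else 0) + (if p' = p.swap then B₂ else 0)) := by
    rintro ⟨i, j⟩ hp ⟨k, l⟩ hp'
    have hij : i ≠ j := (Finset.mem_offDiag.1 hp).2.2
    have hkl : k ≠ l := (Finset.mem_offDiag.1 hp').2.2
    rw [mean_conflict]
    simp only [Prod.mk.injEq, Prod.swap_prod_mk]
    have n1 : ∀ (P : Prop) [Decidable P] (B : ℝ), 0 ≤ B → 0 ≤ if P then B else 0 := by
      intro P _ B hB
      split_ifs
      · exact hB
      · exact le_rfl
    have a1 := n1 (k = i) B₃ h₃
    have a2 := n1 (k = j) B₃ h₃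
    have a3 := n1 (l = i) B₃ h₃
    have a4 := n1 (l = j) B₃ h₃
    have a5 := n1 (k = i ∧ l = j) B₂ h₂
    have a6 := n1 (k = j ∧ l = i) B₂ h₂
    by_cases h1 : k = i
    · subst h1
      by_cases h2 : l = j
      · subst h2
        have := hpair hij
        simp only [and_self, if_true] at a1 a2 a3 a4 a5 a6 ⊢
        linarith
      · have := uprob_conflict_path_le hC hD hij hkl (Ne.symm h2)
        rw [if_pos rfl] at *
        linarith
    by_cases h2 : l = j
    · subst h2
      have := uprob_conflict_path_le hC hD hij.symm hkl.symm (Ne.symm h1)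
      simp only [hsymm (tuple _ l)] at this
      rw [if_pos (rfl : l = l)] at *
      linarith
    by_cases h3 : k = j
    · subst h3
      by_cases h4 : l = i
      · subst h4
        have := hpair hij
        simp only [hsymm (tuple _ k) (tuple _ l), and_self, if_true] at a1 a2 a3 a4 a5 a6 ⊢
        linarith
      · have := uprob_conflict_path_le hC hD hij.symm hkl (Ne.symm h4)
        simp only [hsymm (tuple _ k) (tuple _ i)] at this
        rw [if_pos (rfl : k = k)] at *
        linarith
    by_cases h4 : l = i
    · subst h4
      have := uprob_conflict_path_le hC hD hij hkl.symm (Ne.symm h3)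
      simp only [hsymm (tuple _ l) (tuple _ k)] at this
      rw [if_pos (rfl : l = l)] at *
      linarith
    · have := uprob_conflict_conflict_le (C := C) hij (Ne.symm h1) (Ne.symm h4) (Ne.symm h3)
        (Ne.symm h2) hkl
      linarith
  have hsq : (fun σ => conflictCount C I σ ^ 2) = fun σ : Fin n × Fin r ≃ Fin (r * n) =>
      ∑ p ∈ I.offDiag, ∑ p' ∈ I.offDiag,
        (if C (tuple σ p.1) (tuple σ p.2) then (1 : ℝ) else 0) *
        (if C (tuple σ p'.1) (tuple σ p'.2) then (1 : ℝ) else 0) := by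
    funext σ
    unfold conflictCount
    rw [sq, Finset.sum_mul_sum]
  have hfst : ∀ v, ∑ p' ∈ I.offDiag, (if p'.1 = v then B₃ else 0) ≤ I.card * B₃ := by
    intro v
    rw [← Finset.sum_filter, Finset.sum_const, nsmul_eq_mul]
    gcongr
    refine Finset.card_le_card_of_injOn Prod.snd ?_ ?_
    · intro p hp
      exact (Finset.mem_offDiag.1 (Finset.mem_filter.1 hp).1).2.1
    · intro p hp p' hp' h
      exact Prod.ext ((Finset.mem_filter.1 hp).2.trans (Finset.mem_filter.1 hp').2.symm) h
  have hsnd : ∀ v, ∑ p' ∈ I.offDiag, (if p'.2 = v then B₃ else 0) ≤ I.card * B₃ := by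
    intro v
    rw [← Finset.sum_filter, Finset.sum_const, nsmul_eq_mul]
    gcongr
    refine Finset.card_le_card_of_injOn Prod.fst ?_ ?_
    · intro p hp
      exact (Finset.mem_offDiag.1 (Finset.mem_filter.1 hp).1).1
    · intro p hp p' hp' h
      exact Prod.ext h ((Finset.mem_filter.1 hp).2.trans (Finset.mem_filter.1 hp').2.symm)
  have heq : ∀ v, ∑ p' ∈ I.offDiag, (if p' = v then B₂ else 0) ≤ B₂ := by
    intro v
    rw [Finset.sum_ite_eq']
    split_ifs
    · exact le_rfl
    · exact h₂
  rw [hsq, mean_sum]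
  have hrow : ∀ p ∈ I.offDiag, mean (fun σ : Fin n × Fin r ≃ Fin (r * n) =>
      ∑ p' ∈ I.offDiag, (if C (tuple σ p.1) (tuple σ p.2) then (1 : ℝ) else 0) *
        (if C (tuple σ p'.1) (tuple σ p'.2) then (1 : ℝ) else 0)) ≤
      I.offDiag.card * B₄ + 4 * I.card * B₃ + 2 * B₂ := by
    intro p hp
    rw [mean_sum]
    refine (Finset.sum_le_sum fun p' hp' => hterm p hp p' hp').trans ?_
    simp only [Finset.sum_add_distrib]
    rw [Finset.sum_const, nsmul_eq_mul]
    have e1 := hfst p.1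
    have e2 := hfst p.2
    have e3 := hsnd p.1
    have e4 := hsnd p.2
    have e5 := heq p
    have e6 := heq p.swap
    linarith
  refine (Finset.sum_le_sum hrow).trans (le_of_eq ?_)
  rw [Finset.sum_const, nsmul_eq_mul]

end Counts

/-! ### Concentration and deletion of conflicts -/

section Tail

variable {r n : ℕ}

/-- With `L = rn`, Bernoulli's inequality gives `(L)_m ≥ L^m (1 - m²/L)`; here `m²/L ≤ η/2`, and `(1
+ η)(1 - η/2) ≥ 1` as `η ≤ 1`. -/
theorem pow_le_mul_descFactorial {η : ℝ} (hr : 0 < r) (hn : 32 * r ≤ n)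
    (hη : η = 32 * r / n) {m : ℕ} (hm : m ≤ 4 * r) :
    ((r * n : ℕ) : ℝ) ^ m ≤ (1 + η) * ((r * n).descFactorial m : ℝ) := by
  have hn0 : 0 < n := by omega
  have hrR : (0 : ℝ) < r := by exact_mod_cast hr
  have hnR : (0 : ℝ) < n := by exact_mod_cast hn0
  have hL : (0 : ℝ) < ((r * n : ℕ) : ℝ) := by exact_mod_cast Nat.mul_pos hr hn0
  have hmL : m ≤ r * n := by nlinarith
  have hη1 : η ≤ 1 := by
    rw [hη, div_le_one hnR]; exact_mod_cast hn
  have hη0 : 0 ≤ η := by rw [hη]; positivity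
  have h1 : (((r * n : ℕ) : ℝ) - m) ^ m ≤ ((r * n).descFactorial m : ℝ) := by
    have h2 : (r * n - m) ^ m ≤ (r * n).descFactorial m :=
      (Nat.pow_le_pow_left (by omega) m).trans (Nat.pow_sub_le_descFactorial _ _)
    have h3 : (((r * n - m) ^ m : ℕ) : ℝ) ≤ ((r * n).descFactorial m : ℝ) := by exact_mod_cast h2
    rwa [Nat.cast_pow, Nat.cast_sub hmL] at h3
  have hmR : (m : ℝ) ≤ 4 * r := by exact_mod_cast hm
  have h2 : 1 + (m : ℝ) * (-(m / ((r * n : ℕ) : ℝ))) ≤ (1 + -(m / ((r * n : ℕ) : ℝ))) ^ m := by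
    apply one_add_mul_le_pow
    have : (m : ℝ) / ((r * n : ℕ) : ℝ) ≤ 1 := by
      rw [div_le_one hL]; exact_mod_cast hmL
    linarith
  have h3 : (m : ℝ) * (m / ((r * n : ℕ) : ℝ)) ≤ η / 2 := by
    rw [hη, ← mul_div_assoc, div_div, div_le_div_iff₀ hL (by positivity)]
    push_cast
    have : (m : ℝ) * m ≤ (4 * r) * (4 * r) := by gcongr
    nlinarith [mul_le_mul_of_nonneg_right this hnR.le]
  have h4 : 1 - η / 2 ≤ (1 + -(m / ((r * n : ℕ) : ℝ))) ^ m := by linarith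
  have h5 : ((r * n : ℕ) : ℝ) ^ m * (1 + -(m / ((r * n : ℕ) : ℝ))) ^ m
      = (((r * n : ℕ) : ℝ) - m) ^ m := by
    rw [← mul_pow]; congr 1; field_simp; ring
  calc ((r * n : ℕ) : ℝ) ^ m ≤ ((r * n : ℕ) : ℝ) ^ m * ((1 + η) * (1 - η / 2)) := by
        apply le_mul_of_one_le_right (by positivity)
        nlinarith
    _ ≤ ((r * n : ℕ) : ℝ) ^ m * ((1 + η) * (1 + -(m / ((r * n : ℕ) : ℝ))) ^ m) := by gcongr
    _ = (1 + η) * (((r * n : ℕ) : ℝ) - m) ^ m := by rw [← h5]; ring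
    _ ≤ _ := by gcongr

variable {G : Finset (Fin r → Fin (r * n))}
  {C : (Fin r → Fin (r * n)) → (Fin r → Fin (r * n)) → Prop} [DecidableRel C]
  {I : Finset (Fin n)}

theorem div_le_mul_div {F Λ η u : ℝ} (hF : 0 < F) (hΛ : 0 < Λ) (h : Λ ≤ (1 + η) * F)
    (hu : 0 ≤ u) : u / F ≤ (1 + η) * (u / Λ) := by
  rw [← mul_div_assoc, div_le_div_iff₀ hF hΛ]
  calc u * Λ ≤ u * ((1 + η) * F) := by gcongr
    _ = _ := by ring

/-- Here `ν` is the number of edges considered, `S` that of good tuples, `Λ = (rn)^r`, and `F₁`,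
`F₂` are the falling factorials replacing `Λ`, `Λ²`. The replacement costs `η β²`, which `η β ≤ 2`
reduces to order `β`. -/
theorem variance_goodCount_arith {ν S Λ η β F₁ F₂ V : ℝ} (hν : 0 ≤ ν) (hS : 0 ≤ S) (hΛ : 0 < Λ)
    (hF₁ : 0 < F₁) (hF₂ : 0 < F₂) (h₁ : Λ ≤ (1 + η) * F₁) (h₁' : F₁ ≤ Λ)
    (h₂ : Λ ^ 2 ≤ (1 + η) * F₂) (hη1 : η ≤ 1) (hβ0 : 0 < β)
    (hβ : β = ν * (S / Λ)) (hηβ : η * β ≤ 2)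
    (hV : V ≤ ν * (S / F₁) + ν ^ 2 * (S ^ 2 / F₂)) :
    β ≤ ν * (S / F₁) ∧ V - (ν * (S / F₁)) ^ 2 ≤ 4 * β := by
  have e1 : β ≤ ν * (S / F₁) := by
    rw [hβ]
    exact mul_le_mul_of_nonneg_left (div_le_div_of_nonneg_left hS hF₁ h₁') hν
  refine ⟨e1, ?_⟩
  have e2 : ν * (S / F₁) ≤ (1 + η) * β := by
    calc ν * (S / F₁) ≤ ν * ((1 + η) * (S / Λ)) :=
          mul_le_mul_of_nonneg_left (div_le_mul_div hF₁ hΛ h₁ hS) hν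
      _ = _ := by rw [hβ]; ring
  have e3 : ν ^ 2 * (S ^ 2 / F₂) ≤ (1 + η) * β ^ 2 := by
    calc ν ^ 2 * (S ^ 2 / F₂) ≤ ν ^ 2 * ((1 + η) * (S ^ 2 / Λ ^ 2)) :=
          mul_le_mul_of_nonneg_left (div_le_mul_div hF₂ (by positivity) h₂ (by positivity))
            (by positivity)
      _ = _ := by rw [hβ]; ring
  have e4 : β ^ 2 ≤ (ν * (S / F₁)) ^ 2 := pow_le_pow_left₀ hβ0.le e1 2
  have e5 : η * β ^ 2 ≤ 2 * β := by nlinarith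
  have e6 : (1 + η) * β ≤ 2 * β := by nlinarith
  linarith

/-- In the same notation `x` approximates the expected number of conflicts of one good edge, so `β
x` bounds the main term of the mean. The contributions of the three overlap types are bounded by `γ²
+ β/8`, `β/32` and `β/4`, and `γ²` cancels against the squared mean. -/
theorem variance_conflictCount_arith {ν S d c N Λ η β x F₂ F₃ F₄ V : ℝ} (hν : 0 ≤ ν) (hS : 0 ≤ S)
    (hd : 0 ≤ d) (hc : 0 ≤ c) (hN : 0 ≤ N) (hcS : c ≤ S * d) (hNν : N ≤ ν ^ 2) (hΛ : 0 < Λ)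
    (hF₂ : 0 < F₂) (hF₃ : 0 < F₃) (hF₄ : 0 < F₄) (h₂ : Λ ^ 2 ≤ (1 + η) * F₂) (h₂' : F₂ ≤ Λ ^ 2)
    (h₃ : Λ ^ 3 ≤ (1 + η) * F₃) (h₄ : Λ ^ 4 ≤ (1 + η) * F₄) (hη0 : 0 ≤ η) (hη1 : η ≤ 1)
    (hβ0 : 0 < β) (hβ : β = ν * (S / Λ)) (hx : x = ν * (d / Λ)) (hx1 : 16 * x ≤ 1)
    (hηβ : η * β ≤ 2)
    (hV : V ≤ N * (N * (c ^ 2 / F₄) + 4 * ν * (S * d ^ 2 / F₃) + 2 * (S * d / F₂))) :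
    N * (c / F₂) ≤ β / 8 ∧ V - (N * (c / F₂)) ^ 2 ≤ β := by
  have hx0 : 0 ≤ x := by rw [hx]; positivity
  obtain ⟨γ, hγ⟩ : ∃ γ, γ = N * (c / Λ ^ 2) := ⟨_, rfl⟩
  have hγ0 : 0 ≤ γ := by rw [hγ]; positivity
  have hγβ : γ ≤ β * x := by
    calc γ ≤ ν ^ 2 * (S * d / Λ ^ 2) := by rw [hγ]; gcongr
      _ = β * x := by rw [hβ, hx]; ring
  have hβx : β * x ≤ β / 16 := by nlinarith
  have e1 : γ ≤ N * (c / F₂) := by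
    rw [hγ]
    exact mul_le_mul_of_nonneg_left (div_le_div_of_nonneg_left hc hF₂ h₂') hN
  have e2 : N * (c / F₂) ≤ (1 + η) * γ := by
    calc N * (c / F₂) ≤ N * ((1 + η) * (c / Λ ^ 2)) :=
          mul_le_mul_of_nonneg_left (div_le_mul_div hF₂ (by positivity) h₂ hc) hN
      _ = _ := by rw [hγ]; ring
  have e3 : (1 + η) * γ ≤ 2 * γ := by nlinarith
  refine ⟨by linarith, ?_⟩
  have e4 : N * (N * (c ^ 2 / F₄)) ≤ (1 + η) * γ ^ 2 := by
    have := div_le_mul_div hF₄ (by positivity) h₄ (u := c ^ 2) (by positivity)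
    calc N * (N * (c ^ 2 / F₄)) ≤ N * (N * ((1 + η) * (c ^ 2 / Λ ^ 4))) := by gcongr
      _ = _ := by rw [hγ]; ring
  have e5 : N * (4 * ν * (S * d ^ 2 / F₃)) ≤ 8 * (β * x ^ 2) := by
    have := div_le_mul_div hF₃ (by positivity) h₃ (u := S * d ^ 2) (by positivity)
    calc N * (4 * ν * (S * d ^ 2 / F₃))
        ≤ ν ^ 2 * (4 * ν * ((1 + η) * (S * d ^ 2 / Λ ^ 3))) := by gcongr
      _ = (1 + η) * (4 * (β * x ^ 2)) := by rw [hβ, hx]; ring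
      _ ≤ 2 * (4 * (β * x ^ 2)) := by gcongr; linarith
      _ = _ := by ring
  have e6 : N * (2 * (S * d / F₂)) ≤ 4 * (β * x) := by
    have := div_le_mul_div hF₂ (by positivity) h₂ (u := S * d) (by positivity)
    calc N * (2 * (S * d / F₂)) ≤ ν ^ 2 * (2 * ((1 + η) * (S * d / Λ ^ 2))) := by gcongr
      _ = (1 + η) * (2 * (β * x)) := by rw [hβ, hx]; ring
      _ ≤ 2 * (2 * (β * x)) := by gcongr; linarith
      _ = _ := by ring
  have e7 : γ ^ 2 ≤ (N * (c / F₂)) ^ 2 := pow_le_pow_left₀ hγ0 e1 2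
  have e8 : η * γ ^ 2 ≤ β / 8 := by
    have : γ ^ 2 ≤ (β / 16) ^ 2 := pow_le_pow_left₀ hγ0 (by linarith) 2
    calc η * γ ^ 2 ≤ η * (β / 16) ^ 2 := by gcongr
      _ = (η * β) * (β / 256) := by ring
      _ ≤ 2 * (β / 256) := by gcongr
      _ ≤ _ := by linarith
  have e9 : β * x ^ 2 ≤ β / 256 := by
    have : x ^ 2 ≤ (1 / 16) ^ 2 := pow_le_pow_left₀ hx0 (by linarith) 2
    calc β * x ^ 2 ≤ β * (1 / 16) ^ 2 := by gcongr
      _ = _ := by ring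
  rw [mul_add, mul_add] at hV
  linarith

/-- With high probability the number of good edges substantially exceeds the number of
conflicts. -/
theorem uprob_goodCount_sub_conflictCount_lt_le (hG : ∀ g ∈ G, Function.Injective g)
    (hC : ∀ g g', C g g' → g ∈ G) (hCs : ∀ g g', C g g' → C g' g)
    (hCd : ∀ g g', C g g' → ∀ a b, g a ≠ g' b) {D : ℕ}
    (hD : ∀ g, (Finset.univ.filter (C g)).card ≤ D) (hL : 0 < r * n) {η β x : ℝ}
    (hη : ∀ m ≤ 4 * r, ((r * n : ℕ) : ℝ) ^ m ≤ (1 + η) * ((r * n).descFactorial m : ℝ))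
    (hη0 : 0 ≤ η) (hη1 : η ≤ 1) (hβ0 : 0 < β)
    (hβ : β = I.card * ((G.card : ℝ) / ((r * n : ℕ) : ℝ) ^ r))
    (hx : x = I.card * ((D : ℝ) / ((r * n : ℕ) : ℝ) ^ r)) (hx1 : 16 * x ≤ 1) (hηβ : η * β ≤ 2) :
    uprob (fun σ => goodCount G I σ - conflictCount C I σ < β / 4) ≤ 80 / β := by
  have hLR : (0 : ℝ) < ((r * n : ℕ) : ℝ) := by exact_mod_cast hL
  have hpow : ∀ k, ((r * n : ℕ) : ℝ) ^ (k * r) = (((r * n : ℕ) : ℝ) ^ r) ^ k := by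
    intro k
    rw [← pow_mul, mul_comm k r]
  have hle : ∀ k ≤ 4, (((r * n : ℕ) : ℝ) ^ r) ^ k
      ≤ (1 + η) * ((r * n).descFactorial (k * r) : ℝ) := by
    intro k hk
    rw [← hpow]
    exact hη (k * r) (Nat.mul_le_mul_right _ hk)
  have hpos : ∀ k ≤ 4, (0 : ℝ) < ((r * n).descFactorial (k * r) : ℝ) := by
    intro k hk
    by_contra hn
    have h0 : ((r * n).descFactorial (k * r) : ℝ) = 0 :=
      le_antisymm (not_lt.1 hn) (Nat.cast_nonneg _)
    have h1 := hle k hk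
    rw [h0, mul_zero] at h1
    exact absurd h1 (not_le.2 (by positivity))
  have hge : ∀ k, ((r * n).descFactorial (k * r) : ℝ) ≤ (((r * n : ℕ) : ℝ) ^ r) ^ k := by
    intro k
    rw [← hpow]
    exact_mod_cast Nat.descFactorial_le_pow _ _
  have hC' : ∀ g g', C g g' → g' ∈ G := fun g g' h => hC _ _ (hCs _ _ h)
  have hcS : (pairCount C : ℝ) ≤ (G.card : ℝ) * (D : ℝ) := by
    exact_mod_cast pairCount_le hC hD
  have hNν : (I.offDiag.card : ℝ) ≤ (I.card : ℝ) ^ 2 := by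
    have : I.offDiag.card ≤ I.card ^ 2 := by
      rw [Finset.offDiag_card, sq]; exact Nat.sub_le _ _
    exact_mod_cast this
  have hle1 := hle 1 (by norm_num)
  have hpos1 := hpos 1 (by norm_num)
  have hge1 := hge 1
  rw [pow_one, one_mul] at hle1 hge1
  rw [one_mul] at hpos1
  obtain ⟨x1, x2⟩ := variance_goodCount_arith (Nat.cast_nonneg _) (Nat.cast_nonneg _)
    (pow_pos hLR r) hpos1 (hpos 2 (by norm_num)) hle1 hge1 (hle 2 (by norm_num)) hη1 hβ0 hβ hηβ
    (mean_goodCount_sq_le I hG)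
  obtain ⟨y1, y2⟩ := variance_conflictCount_arith (Nat.cast_nonneg _) (Nat.cast_nonneg _)
    (Nat.cast_nonneg _) (Nat.cast_nonneg _) (Nat.cast_nonneg _) hcS hNν
    (pow_pos hLR r) (hpos 2 (by norm_num)) (hpos 3 (by norm_num)) (hpos 4 le_rfl)
    (hle 2 (by norm_num)) (hge 2) (hle 3 (by norm_num)) (hle 4 le_rfl) hη0 hη1 hβ0 hβ hx hx1 hηβ
    (mean_conflictCount_sq_le I hG hC hCs hCd hD)
  rw [← mean_goodCount I hG] at x1 x2
  rw [← mean_conflictCount I hG hC hC' hCd] at y1 y2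
  -- The means differ by at least `7β/8`, so two deviations below `β/4` leave more than `β/4`.
  -- Chebyshev's inequality then gives `64/β + 16/β`.
  have hsub : ∀ σ : Fin n × Fin r ≃ Fin (r * n),
      goodCount G I σ - conflictCount C I σ < β / 4 →
      β / 4 ≤ |goodCount G I σ - mean (goodCount G I)| ∨
        β / 4 ≤ |conflictCount C I σ - mean (conflictCount C I)| := by
    intro σ hσ
    by_contra! hn
    have h1 := (abs_lt.1 hn.1).1
    have h2 := (abs_lt.1 hn.2).2
    linarith
  have hε : 0 < β / 4 := by positivity
  have hε2 : 0 < (β / 4) ^ 2 := by positivity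
  have b3 := (uprob_le_of_sq (goodCount G I) rfl hε).trans (div_le_div_of_nonneg_right x2 hε2.le)
  have b4 := (uprob_le_of_sq (conflictCount C I) rfl hε).trans
    (div_le_div_of_nonneg_right y2 hε2.le)
  refine (uprob_mono hsub).trans ((uprob_or_le _ _).trans ((add_le_add b3 b4).trans (le_of_eq ?_)))
  field_simp
  ring

/-- Removing the first edge of every conflicting pair leaves good edges without conflicts. -/
theorem goodCount_sub_conflictCount_le (hr : 0 < r) {P : Pattern r} {c : Composition r}
    {y : Fin c.length → Bool} (hy : Represents (blockWord c y) P)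
    {π : Finpartition (Finset.univ : Finset (Fin c.length))} {q w : ℕ} (h : q * w ≤ n)
    [DecidableRel (Conflict y π h)] (σ : Fin n × Fin r ≃ Fin (r * n)) :
    goodCount (goodTuples y π h) I σ - conflictCount (Conflict y π h) I σ
      ≤ maxClique (cube P c π) (matchingOf σ) := by
  classical
  let A := I.filter (fun i => tuple σ i ∈ goodTuples y π h)
  let B := I.offDiag.filter (fun p => Conflict y π h (tuple σ p.1) (tuple σ p.2))
  have hA : goodCount (goodTuples y π h) I σ = A.card := by
    unfold goodCount
    simp only [A, Finset.card_filter]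
    push_cast
    congr!
  have hB : conflictCount (Conflict y π h) I σ = B.card := by
    unfold conflictCount
    simp only [B, Finset.card_filter]
    push_cast
    rfl
  have h1 : (A \ B.image Prod.fst).card ≤ maxClique (cube P c π) (matchingOf σ) := by
    apply card_le_maxClique hr hy h σ
    · intro i hi
      exact (Finset.mem_filter.1 (Finset.mem_sdiff.1 hi).1).2
    · intro i hi j hj hij hconf
      apply (Finset.mem_sdiff.1 hi).2
      refine Finset.mem_image.2 ⟨(i, j), Finset.mem_filter.2 ⟨Finset.mem_offDiag.2
        ⟨(Finset.mem_filter.1 (Finset.mem_sdiff.1 hi).1).1,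
          (Finset.mem_filter.1 (Finset.mem_sdiff.1 hj).1).1, hij⟩, hconf⟩, rfl⟩
  have h2 : A.card ≤ (A \ B.image Prod.fst).card + B.card := by
    have h3 := Finset.le_card_sdiff (B.image Prod.fst) A
    have h4 : (B.image Prod.fst).card ≤ B.card := Finset.card_image_le
    omega
  rw [hA, hB, sub_le_iff_le_add]
  exact_mod_cast h2.trans (Nat.add_le_add_right h1 _)

end Tail

/-! ### Choice of parameters and the limit -/

section LowerBound

variable {r : ℕ}

/-- When `q^(r-t)` is within a constant factor of `n`, the quantity `β` has order `n q^(t+1) (n/q)^r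
/ (rn)^r`, that is, order `q`. -/
theorem uprob_maxClique_lt_le (hr : 2 ≤ r) {P : Pattern r} {c : Composition r}
    (hP : IsSplitting P c) (π : Finpartition (Finset.univ : Finset (Fin c.length))) {t : ℕ}
    (ht : π.parts.card = t + 1) (htr : t < r) {n q : ℕ} (hn : 32 * r ≤ n) (hq : 0 < q)
    (hqn : q ^ (r - t) ≤ n) (hnq : n < (q + 1) ^ (r - t)) :
    uprob (fun σ : Fin n × Fin r ≃ Fin (r * n) =>
      (maxClique (cube P c π) (matchingOf σ) : ℝ) < q / (4 * (32 * r * (2 * r) ^ r)))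
      ≤ 80 * (32 * r * (2 * r) ^ r) / q := by
  classical
  obtain ⟨y, hy⟩ := isSplitting_iff.1 hP
  have hr0 : 0 < r := by omega
  have hn0 : 0 < n := by omega
  have hqle : q ≤ n := (Nat.le_self_pow (by omega) q).trans hqn
  -- Boxes as long as possible: `n/2 ≤ q w ≤ n`.
  obtain ⟨w, hw⟩ : ∃ w, w = n / q := ⟨_, rfl⟩
  have hw1 : 1 ≤ w := by rw [hw]; exact Nat.div_pos hqle hq
  have hqw : q * w ≤ n := by rw [hw]; exact Nat.mul_div_le n q
  have hqw2 : n ≤ 2 * (q * w) := by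
    have h1 : n < q * (w + 1) := by rw [hw]; exact Nat.lt_mul_div_succ n hq
    nlinarith
  -- Only about `n/(16r)` edges are used: good edges scale linearly in `ν`, conflicts quadratically,
  -- and this proportion makes `16 x ≤ 1`.
  obtain ⟨ν, hν⟩ : ∃ ν, ν = n / (16 * r) := ⟨_, rfl⟩
  have hν1 : 16 * r * ν ≤ n := by rw [hν]; exact Nat.mul_div_le n _
  have hν2 : n ≤ 32 * r * ν := by
    have h1 : n < 16 * r * (ν + 1) := by rw [hν]; exact Nat.lt_mul_div_succ n (by omega)
    have h2 : 1 ≤ ν := by rw [hν]; exact Nat.div_pos (by omega) (by omega)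
    nlinarith
  have hνn : ν ≤ n := by nlinarith
  let I : Finset (Fin n) := Finset.univ.map (Fin.castLEEmb hνn)
  have hI : I.card = ν := by simp [I]
  have hexp : q ^ (r - t) * q ^ (t + 1) = q * q ^ r := by
    rw [← pow_add, ← pow_succ']; congr 1; omega
  -- In integer form, this bound and the next say that `16 r β ≤ q ≤ 32 r (2r)^r β`; the first uses
  -- `2 ≤ r`.
  have hkey1 : 16 * r * (ν * (q ^ (t + 1) * w ^ r)) ≤ q * (r * n) ^ r := by
    have h1 : n ≤ 2 ^ r * q ^ (r - t) := by
      calc n ≤ (q + 1) ^ (r - t) := hnq.le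
        _ ≤ (2 * q) ^ (r - t) := Nat.pow_le_pow_left (by omega) _
        _ = 2 ^ (r - t) * q ^ (r - t) := mul_pow _ _ _
        _ ≤ 2 ^ r * q ^ (r - t) :=
          Nat.mul_le_mul_right _ (Nat.pow_le_pow_right (by norm_num) (Nat.sub_le _ _))
    calc 16 * r * (ν * (q ^ (t + 1) * w ^ r)) = 16 * r * ν * (q ^ (t + 1) * w ^ r) := by ring
      _ ≤ (2 ^ r * q ^ (r - t)) * (q ^ (t + 1) * w ^ r) := Nat.mul_le_mul_right _ (hν1.trans h1)
      _ = 2 ^ r * (q ^ (r - t) * q ^ (t + 1)) * w ^ r := by ring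
      _ = q * (2 * (q * w)) ^ r := by rw [hexp, mul_pow, mul_pow]; ring
      _ ≤ q * (r * n) ^ r :=
        Nat.mul_le_mul_left _ (Nat.pow_le_pow_left (Nat.mul_le_mul hr hqw) _)
  have hkey2 : q * (r * n) ^ r ≤ 32 * r * (2 * r) ^ r * (ν * (q ^ (t + 1) * w ^ r)) := by
    calc q * (r * n) ^ r ≤ q * (r * (2 * (q * w))) ^ r :=
          Nat.mul_le_mul_left _ (Nat.pow_le_pow_left (Nat.mul_le_mul_left _ hqw2) _)
      _ = (2 * r) ^ r * w ^ r * (q * q ^ r) := by simp only [mul_pow]; ring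
      _ = (2 * r) ^ r * w ^ r * q ^ (t + 1) * q ^ (r - t) := by rw [← hexp]; ring
      _ ≤ (2 * r) ^ r * w ^ r * q ^ (t + 1) * (32 * r * ν) :=
          Nat.mul_le_mul_left _ (hqn.trans hν2)
      _ = _ := by ring
  obtain ⟨β, hβ⟩ : ∃ β : ℝ, β = (I.card : ℝ) * (((goodTuples y π hqw).card : ℝ) /
    ((r * n : ℕ) : ℝ) ^ r) := ⟨_, rfl⟩
  obtain ⟨D, hD⟩ : ∃ D, D = (t + 1) * (q ^ t * w ^ r) := ⟨_, rfl⟩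
  have hrR : (0 : ℝ) < r := by exact_mod_cast hr0
  have hnR : (0 : ℝ) < n := by exact_mod_cast hn0
  have hqR : (0 : ℝ) < q := by exact_mod_cast hq
  have hΛ : (0 : ℝ) < ((r * n : ℕ) : ℝ) ^ r := by
    have : 0 < r * n := Nat.mul_pos hr0 hn0
    positivity
  have hβ' : β = ((ν * (q ^ (t + 1) * w ^ r) : ℕ) : ℝ) / ((r * n : ℕ) : ℝ) ^ r := by
    rw [hβ, hI, card_goodTuples hr0 ht hqw]
    push_cast
    ring
  have hβup : 16 * r * β ≤ q := by
    rw [hβ', ← mul_div_assoc, div_le_iff₀ hΛ]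
    exact_mod_cast hkey1
  have hβlow : (q : ℝ) ≤ 32 * r * (2 * r) ^ r * β := by
    rw [hβ', ← mul_div_assoc, le_div_iff₀ hΛ]
    exact_mod_cast hkey2
  have hK : (0 : ℝ) < 32 * r * (2 * r) ^ r := by positivity
  have hβ0 : 0 < β := by
    by_contra hneg
    have : 32 * (r : ℝ) * (2 * r) ^ r * β ≤ 0 := mul_nonpos_of_nonneg_of_nonpos hK.le (not_lt.1 hneg)
    linarith
  have hqnR : (q : ℝ) ≤ n := by exact_mod_cast hqle
  have hn32 : 32 * (r : ℝ) ≤ n := by exact_mod_cast hn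
  have hx : 16 * ((I.card : ℝ) * ((D : ℝ) / ((r * n : ℕ) : ℝ) ^ r)) ≤ 1 := by
    have h1 : (I.card : ℝ) * ((D : ℝ) / ((r * n : ℕ) : ℝ) ^ r) = (t + 1) * β / q := by
      rw [hβ', hD, hI]
      push_cast
      field_simp
      ring
    have h2 : ((t : ℝ) + 1) ≤ r := by exact_mod_cast htr
    rw [h1, ← mul_div_assoc, div_le_one hqR]
    calc 16 * (((t : ℝ) + 1) * β) ≤ 16 * (r * β) := by gcongr
      _ = 16 * r * β := by ring
      _ ≤ q := hβup
  have hηβ : 32 * r / n * β ≤ 2 := by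
    rw [div_mul_eq_mul_div, div_le_iff₀ hnR]
    linarith
  have htail := uprob_goodCount_sub_conflictCount_lt_le (G := goodTuples y π hqw)
    (C := Conflict y π hqw) (I := I) (D := D) (η := 32 * r / n) (β := β)
    (fun g hg => by
      obtain ⟨γ, -, rfl⟩ := Finset.mem_image.1 hg
      exact (goodTuple_strictMono γ).injective)
    (fun g g' h => h.mem_left) (fun g g' h => h.symm) (fun g g' h => h.1)
    (fun g => by
      rw [hD]
      convert card_conflict_le hr0 ht hqw g)
    (Nat.mul_pos hr0 hn0)
    (fun m hm => pow_le_mul_descFactorial hr0 hn rfl hm) (by positivity)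
    ((div_le_one hnR).2 hn32) hβ0 hβ rfl hx hηβ
  have hqβ : (q : ℝ) / (32 * r * (2 * r) ^ r) ≤ β := by
    rw [div_le_iff₀ hK]; linarith
  refine (uprob_mono fun σ hσ => ?_).trans (htail.trans ?_)
  · refine (goodCount_sub_conflictCount_le hr0 hy hqw σ).trans_lt (hσ.trans_le ?_)
    calc (q : ℝ) / (4 * (32 * r * (2 * r) ^ r)) = q / (32 * r * (2 * r) ^ r) / 4 := by
          rw [div_div, mul_comm]
      _ ≤ β / 4 := by gcongr
  · rw [div_le_div_iff₀ hβ0 hqR]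
    linarith

theorem card_parts_le (c : Composition r)
    (π : Finpartition (Finset.univ : Finset (Fin c.length))) : π.parts.card ≤ r := by
  refine π.card_parts_le_card.trans ?_
  rw [Finset.card_univ, Fintype.card_fin]
  exact c.length_le

/-- Asymptotic form of the two bounds. -/
theorem tendsto_prob_maxClique (hr : 2 ≤ r) {P : Pattern r} {c : Composition r}
    (hP : IsSplitting P c) (π : Finpartition (Finset.univ : Finset (Fin c.length))) {t : ℕ}
    (ht : π.parts.card = t + 1) :
    ∃ a b : ℝ, 0 < a ∧ 0 < b ∧
      Tendsto (fun n : ℕ => prob r n (fun M =>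
        a * (n : ℝ) ^ (1 / ((r : ℝ) - (t : ℝ))) ≤ (maxClique (cube P c π) M : ℝ) ∧
        (maxClique (cube P c π) M : ℝ) ≤ b * (n : ℝ) ^ (1 / ((r : ℝ) - (t : ℝ)))))
        atTop (𝓝 1) := by
  have hr0 : 0 < r := by omega
  have hrR : (0 : ℝ) < r := by exact_mod_cast hr0
  have htr : t < r := by
    have := card_parts_le c π
    omega
  obtain ⟨d, hd⟩ : ∃ d, d = r - t := ⟨_, rfl⟩
  have hd0 : 0 < d := by omega
  have hdR : (0 : ℝ) < d := by exact_mod_cast hd0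
  have hrt : (r : ℝ) - (t : ℝ) = d := by rw [hd, Nat.cast_sub htr.le]
  simp only [hrt]
  obtain ⟨K, hK⟩ : ∃ K : ℝ, K = 32 * r * (2 * r) ^ r := ⟨_, rfl⟩
  have hK0 : 0 < K := by rw [hK]; positivity
  obtain ⟨N, hN⟩ : ∃ N : ℕ → ℝ, N = fun n : ℕ => (n : ℝ) ^ (1 / (d : ℝ)) := ⟨_, rfl⟩
  have hN0 : ∀ n, 0 ≤ N n := fun n => by rw [hN]; positivity
  have hNd : ∀ n, N n ^ d = n := by
    intro n
    rw [hN]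
    simp only
    rw [← Real.rpow_natCast, ← Real.rpow_mul (Nat.cast_nonneg n), one_div,
      inv_mul_cancel₀ hdR.ne', Real.rpow_one]
  have hNtop : Tendsto N atTop atTop := by
    rw [hN]
    exact (tendsto_rpow_atTop (by positivity)).comp tendsto_natCast_atTop_atTop
  -- Chosen so that `b^d ≥ 2 r! 3^d`, as `first_moment_le` requires.
  obtain ⟨b, hb⟩ : ∃ b : ℝ, b = 6 * r.factorial := ⟨_, rfl⟩
  have hfac : (1 : ℝ) ≤ r.factorial := by exact_mod_cast Nat.factorial_pos r
  have hb0 : 0 < b := by rw [hb]; positivity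
  -- The lower bound is `q / (4K)` with `q = ⌊N n⌋₊`, and `N n < q + 1 ≤ 2q` costs another factor
  -- two.
  refine ⟨1 / (8 * K), b, by positivity, hb0, ?_⟩
  have hNe : ∀ n : ℕ, (n : ℝ) ^ (1 / (d : ℝ)) = N n := fun n => by rw [hN]
  simp only [hNe]
  have hlow : Tendsto (fun n => 1 - (80 * K / (⌊N n⌋₊ : ℝ) + (1 / 2 : ℝ) ^ (⌊b * N n⌋₊ + 1)))
      atTop (𝓝 1) := by
    have h1 : Tendsto (fun n => 80 * K / (⌊N n⌋₊ : ℝ)) atTop (𝓝 0) :=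
      tendsto_const_nhds.div_atTop
        (tendsto_natCast_atTop_atTop.comp (tendsto_nat_floor_atTop.comp hNtop))
    have h2 : Tendsto (fun n => (1 / 2 : ℝ) ^ (⌊b * N n⌋₊ + 1)) atTop (𝓝 0) :=
      (tendsto_pow_atTop_nhds_zero_of_lt_one (by norm_num) (by norm_num)).comp
        ((tendsto_add_atTop_nat 1).comp
          (tendsto_nat_floor_atTop.comp (hNtop.const_mul_atTop hb0)))
    simpa using (h1.add h2).const_sub 1
  refine tendsto_of_tendsto_of_tendsto_of_le_of_le' hlow tendsto_const_nhds ?_ ?_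
  · filter_upwards [eventually_ge_atTop (32 * r), hNtop.eventually_ge_atTop 1] with n hn hN1
    rw [prob_eq_uprob hr0]
    have hq : 0 < ⌊N n⌋₊ := Nat.floor_pos.2 hN1
    have hqN : (⌊N n⌋₊ : ℝ) ≤ N n := Nat.floor_le (hN0 n)
    have hNq : N n < ⌊N n⌋₊ + 1 := Nat.lt_floor_add_one _
    have hq1 : (1 : ℝ) ≤ ⌊N n⌋₊ := by exact_mod_cast hq
    have e1 : ⌊N n⌋₊ ^ (r - t) ≤ n := by
      rw [← hd]
      have : (⌊N n⌋₊ : ℝ) ^ d ≤ n := by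
        rw [← hNd n]; gcongr
      exact_mod_cast this
    have e2 : n < (⌊N n⌋₊ + 1) ^ (r - t) := by
      rw [← hd]
      have : (n : ℝ) < ((⌊N n⌋₊ : ℝ) + 1) ^ d := by
        rw [← hNd n]
        exact pow_lt_pow_left₀ hNq (hN0 n) hd0.ne'
      exact_mod_cast this
    have b1 := uprob_maxClique_lt_le hr hP π ht htr hn hq e1 e2
    rw [← hK] at b1
    have e3 : 2 * (r.factorial : ℝ) * 3 ^ (r - t) * n ≤ ((⌊b * N n⌋₊ + 1 : ℕ) : ℝ) ^ (r - t) := by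
      rw [← hd]
      have h1 : b * N n ≤ ((⌊b * N n⌋₊ + 1 : ℕ) : ℝ) := by
        push_cast
        exact (Nat.lt_floor_add_one _).le
      calc 2 * (r.factorial : ℝ) * 3 ^ d * n ≤ (2 * r.factorial) ^ d * 3 ^ d * n := by
            gcongr
            exact le_self_pow₀ (by linarith) hd0.ne'
        _ = (b * N n) ^ d := by rw [mul_pow b, hNd, hb, ← mul_pow]; congr 2; ring
        _ ≤ _ := pow_le_pow_left₀ (mul_nonneg hb0.le (hN0 n)) h1 d
    have b2 := (uprob_le_maxClique_le hr0 hP π ht n (⌊b * N n⌋₊ + 1)).trans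
      (first_moment_le htr e3)
    refine le_trans ?_ (one_sub_uprob_le (q := fun σ : Fin n × Fin r ≃ Fin (r * n) =>
      (maxClique (cube P c π) (matchingOf σ) : ℝ) < ⌊N n⌋₊ / (4 * K) ∨
      ⌊b * N n⌋₊ + 1 ≤ maxClique (cube P c π) (matchingOf σ)) ?_)
    · have := uprob_or_le (fun σ : Fin n × Fin r ≃ Fin (r * n) =>
        (maxClique (cube P c π) (matchingOf σ) : ℝ) < ⌊N n⌋₊ / (4 * K))
        (fun σ => ⌊b * N n⌋₊ + 1 ≤ maxClique (cube P c π) (matchingOf σ))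
      linarith
    · intro σ hσ
      rw [not_and_or, not_le, not_le] at hσ
      rcases hσ with hσ | hσ
      · left
        refine hσ.trans_le ?_
        rw [one_div_mul_eq_div, div_le_div_iff₀ (by positivity) (by positivity)]
        nlinarith
      · right
        exact Nat.succ_le_of_lt ((Nat.floor_lt (mul_nonneg hb0.le (hN0 n))).2 hσ)
  · refine Eventually.of_forall fun n => ?_
    rw [prob_eq_uprob hr0]
    exact uprob_le_one _

end LowerBound
end OrdMatch

theorem mainTheorem1 (r : ℕ) (hr : 2 ≤ r) (P : OrdMatch.Pattern r)
    (hP : OrdMatch.Collectable P) :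
    (∃! c : Composition r, OrdMatch.IsSplitting P c) ∧
    ∀ c : Composition r, OrdMatch.IsSplitting P c →
      ∀ (t : ℕ) (π : Finpartition (Finset.univ : Finset (Fin c.length))),
        π.parts.card = t + 1 →
        ∃ a b : ℝ, 0 < a ∧ 0 < b ∧
          Tendsto (fun n : ℕ => OrdMatch.prob r n (fun M =>
              a * (n : ℝ) ^ (1 / ((r : ℝ) - (t : ℝ)))
                ≤ (OrdMatch.maxClique (OrdMatch.cube P c π) M : ℝ) ∧
              (OrdMatch.maxClique (OrdMatch.cube P c π) M : ℝ)
                ≤ b * (n : ℝ) ^ (1 / ((r : ℝ) - (t : ℝ)))))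
            atTop (𝓝 1) := by
  refine ⟨?_, fun c hc t π ht => OrdMatch.tendsto_prob_maxClique hr hc π ht⟩
  obtain ⟨c, hc⟩ := hP.exists_isSplitting (by omega)
  exact ⟨c, hc, fun c' hc' => hc'.unique hc⟩
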